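/- **Setting.** An $\mathfrak{sl}_2$ triad is a triple $(X,Y,Z)$ of real square matrices with $[X,Y]=Z$, $[Z,X]=2X$, $[Z,Y]=-2Y$. For a real $N\times N$ matrix $M$ let $\mathcal D_M f(x)=f'(x)Mx=\sum_i (Mx)_i\,\partial f/\partial x_i$ on $\mathbb R[[x_1,\dots,x_N]]$. The *formal invariants* of the triad are $\ker\mathcal D_Y\subset\mathbb R[[x]]$. A *homogeneous weight invariant* is a nonzero homogeneous polynomial $f$ with $\mathcal D_Yf=0$ and $\mathcal D_Zf=\hat f f$ for a scalar $\hat f$, its *weight* (always a nonnegative integer). A *formal vector space basis* of a subspace $\mathcal J$ of a power series ring is a linearly independent subset of $\mathcal J$ such that every element of $\mathcal J$ is in exactly one way a (possibly infinite) linear combination of its elements, where only finitely many terms contribute to the coefficient of each monomial. A *Hilbert basis* is a finite tuple $\alpha=(\alpha_1,\dots,\alpha_p)$ of homogeneous weight invariants such that every polynomial in $\ker\mathcal D_Y$ is a polynomial in $\alpha_1,\dots,\alpha_p$; write $\alpha^{\mathbf k}=\alpha_1^{k_1}\cdots\alpha_p^{k_p}$ for $\mathbf k\in\mathbb N^p$.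 A *preferred set* is a set $A\subset\mathbb N^p$ such that the $\alpha^{\mathbf k}$ ($\mathbf k\in A$) are distinct and form a formal vector space basis of $\ker\mathcal D_Y$. It is *standard* if $\{t^{\mathbf k}:\mathbf k\in A\}$ is the set of monomials of $\mathbb R[t_1,\dots,t_p]$ that do not lie in some ideal generated by monomials. Let $(X_1,Y_1,Z_1)$ and $(X_2,Y_2,Z_2)$ be $\mathfrak{sl}_2$ triads of $n\times n$ and $m\times m$ matrices, acting on independent variables $x\in\mathbb R^n$ and $y\in\mathbb R^m$, with Hilbert bases $\alpha=(\alpha_1,\dots,\alpha_p)$ and $\beta=(\beta_1,\dots,\beta_q)$ and standard preferred sets $A\subset\mathbb N^p$ and $B\subset\mathbb N^q$. Let $\mathcal J=\ker\mathcal D_{Y}\subset\mathbb R[[x,y]]$ with $Y=\operatorname{diag}(Y_1,Y_2)$. For homogeneous weight invariants $f$ (in $x$) and $g$ (in $y$), and an integer $0\le s\le\min(\hat f,\hat g)$, the *external transvectant* is $$(f,g)^{(s)}=\sum_{j=0}^{s}(-1)^j\binom sj\frac{(\hat f-j)!}{(\hat f-s)!}\,\frac{(\hat g-s+j)!}{(\hat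 g-s)!}\,(\mathcal D_{X_1}^{\,j}f)(\mathcal D_{X_2}^{\,s-j}g)\in\mathbb R[x,y].$$ For $(\mathbf k;\ell;s)\in\mathbb N^{p+q+1}$ write $[\mathbf k;\ell;s]=(\alpha^{\mathbf k},\beta^{\ell})^{(s)}$; it is *well defined* if $s$ is at most the weight of $\alpha^{\mathbf k}$ and at most the weight of $\beta^{\ell}$, and *admissible* if moreover $\mathbf k\in A$ and $\ell\in B$. The *pre-box product* of $A$ and $B$ is the set of all admissible transvectants. A *replacement* for $[\mathbf k;\ell;s]$ is a finite product $\prod_i[\mathbf k_i;\ell_i;s_i]^{m_i}$ of powers of well-defined transvectants with $(\mathbf k;\ell;s)=\sum_i m_i(\mathbf k_i;\ell_i;s_i)$ (in particular $[\mathbf k;\ell;s]$ is a replacement for itself). **Theorem 9.2 (Replacement theorem).** Choose a replacement for each admissible transvectant $[\mathbf k;\ell;s]$. Then the chosen products are pairwise distinct for distinct admissible $(\mathbf k;\ell;s)$, and the set of all of them (a *replacement set* for the pre-box product) is a formal vector space basis of $\mathcal J$. -/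

import Mathlib

noncomputable section

namespace BoxProduct

/-- `(X, Y, Z)` is an `sl₂` triad of matrices:
`[X, Y] = Z`, `[Z, X] = 2X`, `[Z, Y] = -2Y`, where `[A, B] = AB - BA`. -/
structure IsTriad {σ : Type*} [Fintype σ] (X Y Z : Matrix σ σ ℝ) : Prop where
  bracket_X_Y : X * Y - Y * X = Z
  bracket_Z_X : Z * X - X * Z = (2 : ℝ) • X
  bracket_Z_Y : Z * Y - Y * Z = (-2 : ℝ) • Y

/-- The operator `D_A f = f'(x) A x = ∑ i, (A x)_i ∂f/∂x_i` on polynomials. -/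
def linDeriv {σ : Type*} [Fintype σ] (A : Matrix σ σ ℝ) :
    MvPolynomial σ ℝ →ₗ[ℝ] MvPolynomial σ ℝ where
  toFun f := ∑ i, (∑ j, A i j • (MvPolynomial.X j : MvPolynomial σ ℝ)) * MvPolynomial.pderiv i f
  map_add' f g := by simp only [map_add, mul_add, Finset.sum_add_distrib]
  map_smul' c f := by
    simp only [Derivation.map_smul, mul_smul_comm, Finset.smul_sum, RingHom.id_apply]

/-- The operator `D_A f = f'(x) A x = ∑ i, (A x)_i ∂f/∂x_i` on formal power series. -/
def formalLinDeriv {σ : Type*} [Fintype σ] (A : Matrix σ σ ℝ) :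
    MvPowerSeries σ ℝ →ₗ[ℝ] MvPowerSeries σ ℝ where
  toFun f :=
    ∑ i, (∑ j, A i j • (MvPowerSeries.X j : MvPowerSeries σ ℝ)) * MvPowerSeries.pderiv ℝ i f
  map_add' f g := by simp only [map_add, mul_add, Finset.sum_add_distrib]
  map_smul' c f := by
    simp only [Derivation.map_smul, mul_smul_comm, Finset.smul_sum, RingHom.id_apply]

/-- The algebra of formal invariants `ker D_Y` (as a vector space), where `(D_Y, D_X, D_Z)` is the
triad of differential operators attached to the triad `(X, Y, Z)` of matrices. -/
def formalInvariants {σ : Type*} [Fintype σ] (Y : Matrix σ σ ℝ) :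
    Submodule ℝ (MvPowerSeries σ ℝ) :=
  LinearMap.ker (formalLinDeriv Y)

/-- `f` is the (possibly infinite) linear combination `∑ b ∈ B, c b • b` of formal power series:
for each monomial only finitely many terms contribute, and the coefficients add up. -/
def IsFormalSum {σ : Type*} (B : Set (MvPowerSeries σ ℝ)) (c : B → ℝ)
    (f : MvPowerSeries σ ℝ) : Prop :=
  ∀ d : σ →₀ ℕ,
    (Function.support fun b : B => c b * MvPowerSeries.coeff d b.1).Finite ∧
      ∑ᶠ b : B, c b * MvPowerSeries.coeff d b.1 = MvPowerSeries.coeff d f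

/-- `B` is a formal vector space basis of the space `J` of formal power series: `B` is a linearly
independent subset of `J`, and each element of `J` is in exactly one way an infinite linear
combination of elements of `B`. -/
structure IsFormalBasis {σ : Type*} (J : Submodule ℝ (MvPowerSeries σ ℝ))
    (B : Set (MvPowerSeries σ ℝ)) : Prop where
  subset : B ⊆ J
  linearIndepOn : LinearIndepOn ℝ id B
  existsUnique_formalSum : ∀ f ∈ J, ∃! c : B → ℝ, IsFormalSum B c f

/-- The weight of a weight vector `f` of `D_Z`, i.e. the number `w` with `D_Z f = w f`. It is
meant for nonzero homogeneous weight invariants, whose eigenvalue is always a natural number. -/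
def weight {σ : Type*} [Fintype σ] (Z : Matrix σ σ ℝ) (f : MvPolynomial σ ℝ) : ℕ :=
  sInf {w : ℕ | linDeriv Z f = (w : ℝ) • f}

/-- A homogeneous weight invariant: a homogeneous polynomial in `ker D_Y` that is an eigenvector
of `D_Z`. -/
structure IsWeightInvariant {σ : Type*} [Fintype σ] (Y Z : Matrix σ σ ℝ)
    (f : MvPolynomial σ ℝ) : Prop where
  ne_zero : f ≠ 0
  homogeneous : ∃ d : ℕ, f.IsHomogeneous d
  invariant : linDeriv Y f = 0
  eigenvector : ∃ w : ℝ, linDeriv Z f = w • f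

/-- A Hilbert basis: finitely many homogeneous weight invariants such that every polynomial
invariant is a polynomial in them. -/
structure IsHilbertBasis {σ : Type*} [Fintype σ] {p : ℕ} (Y Z : Matrix σ σ ℝ)
    (α : Fin p → MvPolynomial σ ℝ) : Prop where
  weightInvariant : ∀ i, IsWeightInvariant Y Z (α i)
  generates : ∀ f : MvPolynomial σ ℝ, linDeriv Y f = 0 → f ∈ Algebra.adjoin ℝ (Set.range α)

/-- The monomial `α ^ k = α₁ ^ k₁ ⋯ αₚ ^ kₚ`, as a polynomial in `x`. -/
def mono {σ : Type*} {p : ℕ} (α : Fin p → MvPolynomial σ ℝ) (k : Fin p →₀ ℕ) :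
    MvPolynomial σ ℝ :=
  ∏ i, α i ^ k i

/-- A preferred set, given by the exponents `k` of its monomials: the monomials `α ^ k`, `k ∈ A`,
are distinct and form a formal vector space basis of the formal invariants. -/
structure IsPreferredSet {σ : Type*} [Fintype σ] {p : ℕ} (Y : Matrix σ σ ℝ)
    (α : Fin p → MvPolynomial σ ℝ) (A : Set (Fin p →₀ ℕ)) : Prop where
  injOn : Set.InjOn (fun k => (mono α k : MvPowerSeries σ ℝ)) A
  formalBasis :
    IsFormalBasis (formalInvariants Y) ((fun k => (mono α k : MvPowerSeries σ ℝ)) '' A)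

/-- A standard set of (exponents of) monomials in `ℝ[t₁, …, tₚ]`: the monomials that do not
belong to some ideal generated by monomials. -/
def IsStandardSet {p : ℕ} (A : Set (Fin p →₀ ℕ)) : Prop :=
  ∃ S : Set (Fin p →₀ ℕ), A = {k | MvPolynomial.monomial k (1 : ℝ) ∉
    Ideal.span ((fun e => MvPolynomial.monomial e (1 : ℝ)) '' S)}

/-- The coefficient `W = (s choose j) (f̂ - j)! / (f̂ - s)! · (ĝ - s + j)! / (ĝ - s)!` for weights
`f̂ = a` and `ĝ = b`; it is used for `j ≤ s ≤ min a b`, where no subtraction is truncated. -/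
def transvectantCoeff (a b s j : ℕ) : ℝ :=
  (s.choose j : ℝ) * ((Nat.factorial (a - j) : ℝ) / (Nat.factorial (a - s) : ℝ)) *
    ((Nat.factorial (b - s + j) : ℝ) / (Nat.factorial (b - s) : ℝ))

/-- The external transvectant
`(f, g)^(s) = ∑ j ∈ {0, …, s}, (-1)^j W (𝒴₁^j f) (𝒴₂^(s-j) g)` in `ℝ[x, y]`, where `𝒴ᵢ = D_{Xᵢ}`
acts on the left (`i = 1`) and on the right (`i = 2`) variables. -/
def transvectant {σ τ : Type*} [Fintype σ] [Fintype τ]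
    (X₁ Z₁ : Matrix σ σ ℝ) (X₂ Z₂ : Matrix τ τ ℝ)
    (f : MvPolynomial σ ℝ) (g : MvPolynomial τ ℝ) (s : ℕ) : MvPolynomial (σ ⊕ τ) ℝ :=
  ∑ j ∈ Finset.range (s + 1),
    ((-1 : ℝ) ^ j * transvectantCoeff (weight Z₁ f) (weight Z₂ g) s j) •
      (MvPolynomial.rename Sum.inl ((linDeriv X₁)^[j] f) *
        MvPolynomial.rename Sum.inr ((linDeriv X₂)^[s - j] g))

/-- Integer vectors `(k; ℓ; s)`. -/
abbrev ExpVec (p q : ℕ) : Type := (Fin p →₀ ℕ) × (Fin q →₀ ℕ) × ℕ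

/-- The transvectant `[k; ℓ; s] = (α ^ k, β ^ ℓ)^(s)`. -/
def monoTransvectant {σ τ : Type*} [Fintype σ] [Fintype τ] {p q : ℕ}
    (X₁ Z₁ : Matrix σ σ ℝ) (X₂ Z₂ : Matrix τ τ ℝ)
    (α : Fin p → MvPolynomial σ ℝ) (β : Fin q → MvPolynomial τ ℝ) (v : ExpVec p q) :
    MvPolynomial (σ ⊕ τ) ℝ :=
  transvectant X₁ Z₁ X₂ Z₂ (mono α v.1) (mono β v.2.1) v.2.2

/-- `[k; ℓ; s]` is well defined: `s` is at most the weight of `α ^ k` and that of `β ^ ℓ`. -/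
def IsWellDefined {σ τ : Type*} [Fintype σ] [Fintype τ] {p q : ℕ}
    (Z₁ : Matrix σ σ ℝ) (Z₂ : Matrix τ τ ℝ)
    (α : Fin p → MvPolynomial σ ℝ) (β : Fin q → MvPolynomial τ ℝ) (v : ExpVec p q) : Prop :=
  v.2.2 ≤ weight Z₁ (mono α v.1) ∧ v.2.2 ≤ weight Z₂ (mono β v.2.1)

/-- The integer vectors of the admissible transvectants, i.e. of the elements of the
pre-box product of the preferred sets `A` and `B`. -/
def admissibleVectors {σ τ : Type*} [Fintype σ] [Fintype τ] {p q : ℕ}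
    (Z₁ : Matrix σ σ ℝ) (Z₂ : Matrix τ τ ℝ)
    (α : Fin p → MvPolynomial σ ℝ) (β : Fin q → MvPolynomial τ ℝ)
    (A : Set (Fin p →₀ ℕ)) (B : Set (Fin q →₀ ℕ)) : Set (ExpVec p q) :=
  {v | v.1 ∈ A ∧ v.2.1 ∈ B ∧ IsWellDefined Z₁ Z₂ α β v}

/-- The transvectant monomial `∏ [kᵢ; ℓᵢ; sᵢ]`, for a multiset `M` of integer vectors; repeated
members of `M` give powers of transvectants. -/
def transvectantMonomial {σ τ : Type*} [Fintype σ] [Fintype τ] {p q : ℕ}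
    (X₁ Z₁ : Matrix σ σ ℝ) (X₂ Z₂ : Matrix τ τ ℝ)
    (α : Fin p → MvPolynomial σ ℝ) (β : Fin q → MvPolynomial τ ℝ)
    (M : Multiset (ExpVec p q)) : MvPolynomial (σ ⊕ τ) ℝ :=
  (M.map (monoTransvectant X₁ Z₁ X₂ Z₂ α β)).prod

/-- The product of the transvectants with vectors in `M` is a replacement for the transvectant
with vector `v`: all factors are well-defined transvectants, and their vectors add up to `v`. -/
structure IsReplacement {σ τ : Type*} [Fintype σ] [Fintype τ] {p q : ℕ}
    (Z₁ : Matrix σ σ ℝ) (Z₂ : Matrix τ τ ℝ)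
    (α : Fin p → MvPolynomial σ ℝ) (β : Fin q → MvPolynomial τ ℝ)
    (M : Multiset (ExpVec p q)) (v : ExpVec p q) : Prop where
  wellDefined : ∀ u ∈ M, IsWellDefined Z₁ Z₂ α β u
  sum_eq : M.sum = v

end BoxProduct

end

/-!
Write `E₁ = D_{Y₁}` and `E₂ = D_{Y₂}`, both acting on `ℝ[x, y]`, so that `D_Y = E₁ + E₂` with
commuting summands. The argument looks at the *leading term* `E₂ ^ s P` of a polynomial `P` with
`E₂ ^ (s + 1) P = 0`.

In the transvectant `(f, g)^(s)` the operator `E₂ ^ s` kills every term but `f · D_{X₂} ^ s g`, so the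
leading term is a nonzero multiple of `f g` (`hasLeadingTerm_transvectant`). Because `E₂` is a
derivation, leading terms multiply and their orders add (`HasLeadingTerm.mul`); hence every
replacement of `[k; l; s]` has a nonzero multiple of `α ^ k β ^ l` as its leading term, of order `s`
(`transvectantMonomial_properties`). These products are linearly independent for `k ∈ A`, `l ∈ B`, and
therefore so are the replacements (`linearIndepOn_of_hasLeadingTerm`).

For spanning, let `F` be a polynomial with `D_Y F = 0` and `E₂ ^ (s + 1) F = 0`. Then
`G = E₂ ^ s F = ± E₁ ^ s F` is killed by `E₁` and `E₂`, and so is a combination of products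
`α ^ k β ^ l` with `k ∈ A`, `l ∈ B` (`mem_span_mul_of_linDeriv_eq_zero`). By a computation in `sl₂`, a
highest weight vector in the range of `E ^ s` only has components of weight at least `s`
(`exists_weight_eq_of_raise_iterate`), so that only admissible `(k; l; s)` occur in `G`
(`exists_leading_expansion`). Subtracting the corresponding replacements from `F` makes `E₂ ^ s` vanish,
and induction on `s` finishes (`mem_span_of_hasLeadingTerm`); it starts because `E₂` is locally
nilpotent.

Finally, a set of homogeneous polynomials is a formal basis of the formal invariants exactly if it is
a basis of the polynomial invariants, since `D_Y` preserves degrees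
(`IsFormalBasis.ker_linDeriv_le_span`, `isFormalBasis_of_span`).
-/

open MvPolynomial
open scoped TensorProduct

namespace BoxProduct

/-! ### Linear vector fields as derivations -/

section LinDeriv

variable {σ τ : Type*} [Fintype σ] [Fintype τ]

theorem linDeriv_apply (A : Matrix σ σ ℝ) (f : MvPolynomial σ ℝ) :
    linDeriv A f = ∑ i, (∑ j, A i j • (X j : MvPolynomial σ ℝ)) * pderiv i f := rfl

theorem linDeriv_mul (A : Matrix σ σ ℝ) (f g : MvPolynomial σ ℝ) :
    linDeriv A (f * g) = linDeriv A f * g + f * linDeriv A g := by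
  simp only [linDeriv_apply, Derivation.leibniz, smul_eq_mul, Finset.sum_mul, Finset.mul_sum,
    ← Finset.sum_add_distrib]
  refine Finset.sum_congr rfl fun i _ => Finset.sum_congr rfl fun j _ => ?_
  ring

@[simp] theorem linDeriv_C (A : Matrix σ σ ℝ) (c : ℝ) : linDeriv A (C c) = 0 := by
  simp [linDeriv_apply]

@[simp] theorem linDeriv_one (A : Matrix σ σ ℝ) : linDeriv A 1 = 0 := linDeriv_C A 1

@[simp] theorem linDeriv_X (A : Matrix σ σ ℝ) (i : σ) :
    linDeriv A (X i) = ∑ j, A i j • (X j : MvPolynomial σ ℝ) := by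
  classical
  simp [linDeriv_apply, pderiv_X, Pi.single_apply]

theorem linDeriv_add_left (A B : Matrix σ σ ℝ) (f : MvPolynomial σ ℝ) :
    linDeriv (A + B) f = linDeriv A f + linDeriv B f := by
  simp [linDeriv_apply, add_smul, Finset.sum_add_distrib, add_mul]

theorem linDeriv_smul_left (c : ℝ) (A : Matrix σ σ ℝ) (f : MvPolynomial σ ℝ) :
    linDeriv (c • A) f = c • linDeriv A f := by
  simp only [linDeriv_apply, Matrix.smul_apply, smul_eq_mul, mul_smul, ← Finset.smul_sum,
    smul_mul_assoc]

/-- Linear vector fields compose in the opposite order to matrices, whence the swap of `A` and `B`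
on the right. -/
theorem linDeriv_comm (A B : Matrix σ σ ℝ) (f : MvPolynomial σ ℝ) :
    linDeriv A (linDeriv B f) - linDeriv B (linDeriv A f) = linDeriv (B * A - A * B) f := by
  induction f using MvPolynomial.induction_on with
  | C a => simp
  | add p q hp hq => simp only [map_add, ← hp, ← hq]; ring
  | mul_X p i hp =>
    have hX : linDeriv A (linDeriv B (X i)) - linDeriv B (linDeriv A (X i)) =
        linDeriv (B * A - A * B) (X i) := by
      simp only [linDeriv_X, map_sum, map_smul, Finset.smul_sum, Matrix.sub_apply,
        Matrix.mul_apply, sub_smul, Finset.sum_sub_distrib, Finset.sum_smul, smul_smul]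
      congr 1 <;> exact Finset.sum_comm
    simp only [linDeriv_mul, map_add, ← hp, ← hX]
    ring

theorem isHomogeneous_linDeriv (A : Matrix σ σ ℝ) {f : MvPolynomial σ ℝ} {d : ℕ}
    (hf : f.IsHomogeneous d) : (linDeriv A f).IsHomogeneous d := by
  rcases d with _ | d
  · rw [totalDegree_eq_zero_iff_eq_C.1 ((totalDegree_zero_iff_isHomogeneous σ).2 hf), linDeriv_C]
    exact isHomogeneous_zero _ _ _
  · rw [linDeriv_apply, add_comm]
    refine IsHomogeneous.sum _ _ _ fun i _ => IsHomogeneous.mul ?_ hf.pderiv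
    refine IsHomogeneous.sum _ _ _ fun j _ => ?_
    rw [smul_eq_C_mul]
    exact (isHomogeneous_X ℝ j).C_mul _

theorem isHomogeneous_linDeriv_iterate (A : Matrix σ σ ℝ) {f : MvPolynomial σ ℝ} {d : ℕ}
    (hf : f.IsHomogeneous d) (k : ℕ) : ((linDeriv A)^[k] f).IsHomogeneous d := by
  induction k with
  | zero => exact hf
  | succ k ih => rw [Function.iterate_succ_apply']; exact isHomogeneous_linDeriv A ih

theorem linDeriv_fromBlocks_rename_inl (A : Matrix σ σ ℝ) (B : Matrix τ τ ℝ)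
    (f : MvPolynomial σ ℝ) :
    linDeriv (Matrix.fromBlocks A 0 0 B) (rename Sum.inl f) = rename Sum.inl (linDeriv A f) := by
  induction f using MvPolynomial.induction_on with
  | C a => simp
  | add p q hp hq => simp only [map_add, hp, hq]
  | mul_X p i hp => simp [linDeriv_mul, hp]

theorem linDeriv_fromBlocks_rename_inr (A : Matrix σ σ ℝ) (B : Matrix τ τ ℝ)
    (f : MvPolynomial τ ℝ) :
    linDeriv (Matrix.fromBlocks A 0 0 B) (rename Sum.inr f) = rename Sum.inr (linDeriv B f) := by
  induction f using MvPolynomial.induction_on with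
  | C a => simp
  | add p q hp hq => simp only [map_add, hp, hq]
  | mul_X p i hp => simp [linDeriv_mul, hp]

end LinDeriv

/-! ### Leading terms of derivations -/

section Leading

variable {σ : Type*} [Fintype σ]

/-- The Leibniz rule for `D ^ (a + b) (fg)` when `D ^ (a + 1)` kills `f` and `D ^ (b + 1)` kills `g`:
only the term with `D ^ a f` and `D ^ b g` is left. -/
theorem linDeriv_iterate_mul (A : Matrix σ σ ℝ) :
    ∀ (n a b : ℕ) (f g : MvPolynomial σ ℝ), a + b = n → (linDeriv A)^[a + 1] f = 0 →
      (linDeriv A)^[b + 1] g = 0 →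
      (linDeriv A)^[n] (f * g) =
        (n.choose a : ℝ) • ((linDeriv A)^[a] f * (linDeriv A)^[b] g) ∧
      (linDeriv A)^[n + 1] (f * g) = 0 := by
  intro n
  induction n with
  | zero =>
    intro a b f g hab hf hg
    obtain ⟨rfl, rfl⟩ : a = 0 ∧ b = 0 := by omega
    simp only [zero_add, Function.iterate_one] at hf hg
    simp [linDeriv_mul, hf, hg]
  | succ n ih =>
    intro a b f g hab hf hg
    have key : (linDeriv A)^[n + 1] (f * g) =
        ((n + 1).choose a : ℝ) • ((linDeriv A)^[a] f * (linDeriv A)^[b] g) := by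
      rw [Function.iterate_succ_apply, linDeriv_mul, iterate_map_add]
      rcases a with _ | a
      · obtain rfl : b = n + 1 := by omega
        simp only [zero_add, Function.iterate_one] at hf
        have := (ih 0 n f (linDeriv A g) (by omega) (by simpa using hf)
          (by rwa [← Function.iterate_succ_apply])).1
        rw [hf, zero_mul, iterate_map_zero, this]
        simp [Function.iterate_succ_apply]
      · rcases b with _ | b
        · obtain rfl : n = a := by omega
          simp only [zero_add, Function.iterate_one] at hg
          have := (ih n 0 (linDeriv A f) g (by omega)
            (by rwa [← Function.iterate_succ_apply]) (by simpa using hg)).1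
          rw [hg, mul_zero, iterate_map_zero, this]
          simp [Function.iterate_succ_apply]
        · have e1 := (ih a (b + 1) (linDeriv A f) g (by omega)
            (by rwa [← Function.iterate_succ_apply]) hg).1
          have e2 := (ih (a + 1) b f (linDeriv A g) (by omega) hf
            (by rwa [← Function.iterate_succ_apply])).1
          rw [e1, e2, ← Function.iterate_succ_apply, ← Function.iterate_succ_apply, ← add_smul,
            Nat.choose_succ_succ]
          push_cast
          rfl
    refine ⟨key, ?_⟩
    rw [Function.iterate_succ_apply', key, map_smul, linDeriv_mul,
      ← Function.iterate_succ_apply' (linDeriv A), ← Function.iterate_succ_apply' (linDeriv A),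
      hf, hg]
    simp

theorem linDeriv_iterate_eq_zero_of_le (A : Matrix σ σ ℝ) {f : MvPolynomial σ ℝ} {a b : ℕ}
    (hab : a ≤ b) (hf : (linDeriv A)^[a] f = 0) : (linDeriv A)^[b] f = 0 := by
  obtain ⟨c, rfl⟩ := Nat.exists_eq_add_of_le hab
  rw [add_comm, Function.iterate_add_apply, hf, iterate_map_zero]

/-- A nilpotent matrix gives a locally nilpotent derivation. -/
theorem exists_linDeriv_iterate_eq_zero {A : Matrix σ σ ℝ} {k : ℕ}
    [DecidableEq σ] (hA : A ^ k = 0) (f : MvPolynomial σ ℝ) :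
    ∃ n, (linDeriv A)^[n] f = 0 := by
  have hX : ∀ (n : ℕ) (i : σ),
      (linDeriv A)^[n] (X i) = ∑ j, (A ^ n) i j • (X j : MvPolynomial σ ℝ) := by
    intro n i
    induction n with
    | zero => simp [Matrix.one_apply]
    | succ n ih =>
      rw [Function.iterate_succ_apply', ih]
      simp only [map_sum, map_smul, linDeriv_X, Finset.smul_sum, smul_smul, pow_succ,
        Matrix.mul_apply, Finset.sum_smul]
      exact Finset.sum_comm
  induction f using MvPolynomial.induction_on with
  | C a => exact ⟨1, by simp⟩
  | add p q hp hq =>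
    obtain ⟨a, ha⟩ := hp
    obtain ⟨b, hb⟩ := hq
    refine ⟨a + b, ?_⟩
    rw [iterate_map_add, linDeriv_iterate_eq_zero_of_le A (Nat.le_add_right a b) ha,
      linDeriv_iterate_eq_zero_of_le A (Nat.le_add_left b a) hb, add_zero]
  | mul_X p i hp =>
    obtain ⟨a, ha⟩ := hp
    refine ⟨a + k + 1, (linDeriv_iterate_mul A (a + k) a k p (X i) rfl
      (linDeriv_iterate_eq_zero_of_le A (Nat.le_succ a) ha) ?_).2⟩
    exact linDeriv_iterate_eq_zero_of_le A (Nat.le_succ k) (by simp [hX, hA])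

/-- `HasLeadingTerm A s P h`: `D_A ^ (s + 1) P = 0`, and `D_A ^ s P` is a nonzero multiple of `h`. Since
`D_A` is a derivation, such leading terms multiply. -/
def HasLeadingTerm (A : Matrix σ σ ℝ) (s : ℕ) (P h : MvPolynomial σ ℝ) : Prop :=
  (linDeriv A)^[s + 1] P = 0 ∧ ∃ c : ℝ, c ≠ 0 ∧ (linDeriv A)^[s] P = c • h

theorem HasLeadingTerm.one (A : Matrix σ σ ℝ) : HasLeadingTerm A 0 1 1 :=
  ⟨by simp, 1, one_ne_zero, by simp⟩

theorem HasLeadingTerm.mul {A : Matrix σ σ ℝ} {s t : ℕ} {P Q h k : MvPolynomial σ ℝ}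
    (hP : HasLeadingTerm A s P h) (hQ : HasLeadingTerm A t Q k) :
    HasLeadingTerm A (s + t) (P * Q) (h * k) := by
  obtain ⟨hP0, c, hc, hPc⟩ := hP
  obtain ⟨hQ0, d, hd, hQd⟩ := hQ
  obtain ⟨h1, h2⟩ := linDeriv_iterate_mul A (s + t) s t P Q rfl hP0 hQ0
  refine ⟨h2, ((s + t).choose s : ℝ) * (c * d), ?_, ?_⟩
  · have : (s + t).choose s ≠ 0 := (Nat.choose_pos (Nat.le_add_right s t)).ne'
    positivity
  · rw [h1, hPc, hQd, smul_mul_smul_comm, smul_smul]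

end Leading

/-! ### Representations of `sl₂` -/

section Nilpotent

variable {σ : Type*} [Fintype σ] [DecidableEq σ]

/-- A matrix `N` with `[Z, N] = cN`, `c ≠ 0`, is nilpotent: its powers are eigenvectors of
`[Z, ·]` for the eigenvalues `ck`, only finitely many of which can occur. -/
theorem exists_pow_eq_zero_of_commutator {Z N : Matrix σ σ ℝ} {c : ℝ} (hc : c ≠ 0)
    (h : Z * N - N * Z = c • N) : ∃ k, N ^ k = 0 := by
  have hpow : ∀ k : ℕ, Z * N ^ k - N ^ k * Z = (c * k) • N ^ k := by
    intro k
    induction k with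
    | zero => simp
    | succ k ih =>
      have : Z * N ^ (k + 1) - N ^ (k + 1) * Z =
          (Z * N ^ k - N ^ k * Z) * N + N ^ k * (Z * N - N * Z) := by
        rw [pow_succ]; noncomm_ring
      rw [this, ih, h, smul_mul_assoc, mul_smul_comm, ← pow_succ, ← add_smul]
      congr 1
      push_cast
      ring
  by_contra! hne
  let ad : Module.End ℝ (Matrix σ σ ℝ) := LinearMap.mulLeft ℝ Z - LinearMap.mulRight ℝ Z
  have heig : ∀ k : ℕ, ad.HasEigenvalue (c * k) := fun k =>
    Module.End.hasEigenvalue_of_hasEigenvector (x := N ^ k)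
      ⟨Module.End.mem_eigenspace_iff.2 (by simpa [ad] using hpow k), hne k⟩
  refine Set.infinite_of_injective_forall_mem (f := fun k : ℕ => c * (k : ℝ)) ?_ heig
    ad.finite_hasEigenvalue
  intro a b hab
  simpa [hc] using hab

end Nilpotent

section SlTwo

/-! The operators `E`, `F`, `H` raise, lower and measure the weight. In a triad `(X, Y, Z)` of matrices
they are `D_Y`, `D_X` and `D_Z`, because `A ↦ D_A` reverses brackets. -/

variable {V : Type*} [AddCommGroup V] [Module ℝ V] {E F H : V →ₗ[ℝ] V}

theorem iterate_linearMap_smul (T : V →ₗ[ℝ] V) (n : ℕ) (c : ℝ) (u : V) :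
    T^[n] (c • u) = c • T^[n] u := by
  rw [← Module.End.pow_apply, map_smul, Module.End.pow_apply]

theorem raise_iterate_lower (hEF : ∀ u, E (F u) = F (E u) + H u)
    (hHE : ∀ u, H (E u) = E (H u) + (2 : ℝ) • E u) (n : ℕ) (u : V) :
    E^[n + 1] (F u) =
      F (E^[n + 1] u) + ((n : ℝ) + 1) • (H (E^[n] u) - (n : ℝ) • E^[n] u) := by
  induction n with
  | zero => simp [hEF]
  | succ n ih =>
    have hEH : ∀ u, E (H u) = H (E u) - (2 : ℝ) • E u := fun u => by rw [hHE]; abel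
    rw [Function.iterate_succ_apply', ih]
    simp only [map_add, map_smul, map_sub, hEF, hEH, ← Function.iterate_succ_apply' E]
    push_cast
    module

/-- If `u` has `E ^ (j + 1) u = 0` and is killed by a power of `F`, then only weights
`j, j + 1, …` occur in the highest weight vector `E ^ j u`. The reason is that
`E ^ (j + 1) (F u) = (j + 1) (H - j) E ^ j u`; repeated use of this replaces `u` by `F ^ M u = 0`. -/
theorem exists_weight_eq_of_raise_iterate (hEF : ∀ u, E (F u) = F (E u) + H u)
    (hHE : ∀ u, H (E u) = E (H u) + (2 : ℝ) • E u) {ι : Type*} {s : Finset ι} {b : ι → V}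
    (hb : LinearIndepOn ℝ b (s : Set ι)) {w : ι → ℝ} (hw : ∀ i ∈ s, H (b i) = w i • b i)
    (M : ℕ) : ∀ (j : ℕ) (u : V) (c : ι → ℝ), E^[j + 1] u = 0 → F^[M] u = 0 →
      E^[j] u = ∑ i ∈ s, c i • b i → ∀ i ∈ s, c i ≠ 0 → ∃ m : ℕ, w i = (j + m : ℕ) := by
  induction M with
  | zero =>
    intro j u c _ hF hu i hi hci
    rw [Function.iterate_zero, id] at hF
    rw [hF, iterate_map_zero] at hu
    exact absurd (linearIndepOn_finset_iff.1 hb c hu.symm i hi) hci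
  | succ M ih =>
    intro j u c hE hF hu i hi hci
    by_cases hwi : w i = j
    · exact ⟨0, by simpa using hwi⟩
    have key := raise_iterate_lower hEF hHE j u
    rw [hE, map_zero, zero_add] at key
    have hE' : E^[j + 1 + 1] (F u) = 0 := by
      have hEH : ∀ u, E (H u) = H (E u) - (2 : ℝ) • E u := fun u => by rw [hHE]; abel
      rw [Function.iterate_succ_apply', key]
      simp only [map_smul, map_sub, hEH, ← Function.iterate_succ_apply' E, hE]
      simp
    have hu' : E^[j + 1] (F u) = ∑ i ∈ s, (((j : ℝ) + 1) * (w i - j) * c i) • b i := by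
      rw [key, hu, map_sum, Finset.smul_sum, ← Finset.sum_sub_distrib, Finset.smul_sum]
      refine Finset.sum_congr rfl fun i hi => ?_
      rw [map_smul, hw i hi]
      module
    obtain ⟨m, hm⟩ := ih (j + 1) (F u) _ hE' (by rwa [← Function.iterate_succ_apply]) hu' i hi
      (mul_ne_zero (mul_ne_zero (by positivity) (sub_ne_zero.2 hwi)) hci)
    exact ⟨m + 1, by rw [hm]; push_cast; ring⟩

theorem weight_lower_iterate (hHF : ∀ u, H (F u) = F (H u) - (2 : ℝ) • F u) {g : V} {w : ℝ}
    (hw : H g = w • g) (j : ℕ) : H (F^[j] g) = (w - 2 * j) • F^[j] g := by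
  induction j with
  | zero => simp [hw]
  | succ j ih =>
    rw [Function.iterate_succ_apply', hHF, ih, map_smul]
    push_cast
    module

/-- The action of `E` on the string `g, F g, F² g, …` of a highest weight vector `g` of weight `w`. -/
theorem raise_lower_iterate (hEF : ∀ u, E (F u) = F (E u) + H u)
    (hHF : ∀ u, H (F u) = F (H u) - (2 : ℝ) • F u) {g : V} {w : ℝ}
    (hg : E g = 0) (hw : H g = w • g) (j : ℕ) :
    E (F^[j + 1] g) = (((j : ℝ) + 1) * (w - j)) • F^[j] g := by
  induction j with
  | zero => simp [hEF, hg, hw]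
  | succ j ih =>
    rw [Function.iterate_succ_apply', hEF, ih, map_smul, ← Function.iterate_succ_apply' F,
      weight_lower_iterate hHF hw]
    push_cast
    module

/-- The string of a highest weight vector of weight `w` does not break off before `F ^ w g`. -/
theorem raise_iterate_lower_iterate (hEF : ∀ u, E (F u) = F (E u) + H u)
    (hHF : ∀ u, H (F u) = F (H u) - (2 : ℝ) • F u) {g : V} {w : ℕ}
    (hg : E g = 0) (hw : H g = (w : ℝ) • g) {j : ℕ} (hj : j ≤ w) :
    ∃ c : ℝ, c ≠ 0 ∧ E^[j] (F^[j] g) = c • g := by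
  induction j with
  | zero => exact ⟨1, one_ne_zero, by simp⟩
  | succ j ih =>
    obtain ⟨c, hc, h⟩ := ih (by omega)
    refine ⟨((j : ℝ) + 1) * (w - j) * c, mul_ne_zero (mul_ne_zero (by positivity) ?_) hc, ?_⟩
    · exact sub_ne_zero.2 (by exact_mod_cast (show w ≠ j by omega))
    · rw [Function.iterate_succ_apply, raise_lower_iterate hEF hHF hg hw, iterate_linearMap_smul, h,
        smul_smul]

end SlTwo

/-! ### Weight invariants of a triad -/

section Triad

variable {σ : Type*} [Fintype σ] {X Y Z : Matrix σ σ ℝ}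

theorem IsTriad.raise_lower (h : IsTriad X Y Z) (u : MvPolynomial σ ℝ) :
    linDeriv Y (linDeriv X u) = linDeriv X (linDeriv Y u) + linDeriv Z u := by
  rw [← h.bracket_X_Y, ← linDeriv_comm]; abel

theorem IsTriad.weight_raise (h : IsTriad X Y Z) (u : MvPolynomial σ ℝ) :
    linDeriv Z (linDeriv Y u) = linDeriv Y (linDeriv Z u) + (2 : ℝ) • linDeriv Y u := by
  rw [← sub_eq_iff_eq_add', linDeriv_comm, ← neg_sub, h.bracket_Z_Y, ← linDeriv_smul_left]
  simp

theorem IsTriad.weight_lower (h : IsTriad X Y Z) (u : MvPolynomial σ ℝ) :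
    linDeriv Z (linDeriv X u) = linDeriv X (linDeriv Z u) - (2 : ℝ) • linDeriv X u := by
  rw [sub_eq_add_neg, ← sub_eq_iff_eq_add', linDeriv_comm, ← neg_sub, h.bracket_Z_X,
    ← linDeriv_smul_left, ← neg_one_smul ℝ (linDeriv _ u), ← linDeriv_smul_left]
  simp

theorem IsTriad.exists_lower_iterate_eq_zero (h : IsTriad X Y Z) (f : MvPolynomial σ ℝ) :
    ∃ n, (linDeriv X)^[n] f = 0 := by
  classical
  obtain ⟨k, hk⟩ := exists_pow_eq_zero_of_commutator two_ne_zero h.bracket_Z_X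
  exact exists_linDeriv_iterate_eq_zero hk f

theorem IsTriad.exists_raise_iterate_eq_zero (h : IsTriad X Y Z) (f : MvPolynomial σ ℝ) :
    ∃ n, (linDeriv Y)^[n] f = 0 := by
  classical
  obtain ⟨k, hk⟩ := exists_pow_eq_zero_of_commutator (neg_ne_zero.2 two_ne_zero) h.bracket_Z_Y
  exact exists_linDeriv_iterate_eq_zero hk f

theorem isTriad_zero : IsTriad (0 : Matrix σ σ ℝ) 0 0 := ⟨by simp, by simp, by simp⟩

theorem IsTriad.fromBlocks {τ : Type*} [Fintype τ] {X' Y' Z' : Matrix τ τ ℝ}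
    (h : IsTriad X Y Z) (h' : IsTriad X' Y' Z') :
    IsTriad (Matrix.fromBlocks X 0 0 X') (Matrix.fromBlocks Y 0 0 Y')
      (Matrix.fromBlocks Z 0 0 Z') := by
  constructor <;>
    simp [Matrix.fromBlocks_multiply, sub_eq_add_neg, Matrix.fromBlocks_neg,
      Matrix.fromBlocks_add, Matrix.fromBlocks_smul, ← h.bracket_X_Y, ← h'.bracket_X_Y] <;>
    simp only [← sub_eq_add_neg, h.bracket_X_Y, h'.bracket_X_Y, h.bracket_Z_X, h'.bracket_Z_X,
      h.bracket_Z_Y, h'.bracket_Z_Y, neg_smul, and_self]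

/-- The eigenvalue of a weight invariant is a natural number, so that `weight` is not a junk
value. -/
theorem IsWeightInvariant.linDeriv_eq_weight (h : IsTriad X Y Z) {f : MvPolynomial σ ℝ}
    (hf : IsWeightInvariant Y Z f) : linDeriv Z f = (weight Z f : ℝ) • f := by
  obtain ⟨w, hw⟩ := hf.eigenvector
  obtain ⟨M, hM⟩ := h.exists_lower_iterate_eq_zero f
  obtain ⟨m, hm⟩ := exists_weight_eq_of_raise_iterate h.raise_lower h.weight_raise
    (s := Finset.univ) (b := fun _ : Unit => f) (w := fun _ => w)
    (linearIndepOn_finset_iff.2 fun g hg i _ => by simpa [hf.ne_zero] using hg)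
    (fun _ _ => hw) M 0 f 1 (by simpa using hf.invariant) hM (by simp) () (Finset.mem_univ _)
    one_ne_zero
  exact Nat.sInf_mem (s := {w : ℕ | linDeriv Z f = (w : ℝ) • f}) ⟨m, by simpa [hw] using by simp [hm]⟩

theorem isWeightInvariant_one : IsWeightInvariant Y Z (1 : MvPolynomial σ ℝ) :=
  ⟨one_ne_zero, ⟨0, isHomogeneous_one _ _⟩, by simp, 0, by simp⟩

theorem IsWeightInvariant.mul {f g : MvPolynomial σ ℝ} (hf : IsWeightInvariant Y Z f)
    (hg : IsWeightInvariant Y Z g) : IsWeightInvariant Y Z (f * g) := by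
  obtain ⟨d, hd⟩ := hf.homogeneous
  obtain ⟨e, he⟩ := hg.homogeneous
  obtain ⟨a, ha⟩ := hf.eigenvector
  obtain ⟨b, hb⟩ := hg.eigenvector
  refine ⟨mul_ne_zero hf.ne_zero hg.ne_zero, ⟨d + e, hd.mul he⟩, ?_, a + b, ?_⟩
  · simp [linDeriv_mul, hf.invariant, hg.invariant]
  · simp [linDeriv_mul, ha, hb, add_smul]

theorem IsWeightInvariant.pow {f : MvPolynomial σ ℝ} (hf : IsWeightInvariant Y Z f) (k : ℕ) :
    IsWeightInvariant Y Z (f ^ k) := by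
  induction k with
  | zero => simpa using isWeightInvariant_one
  | succ k ih => rw [pow_succ]; exact ih.mul hf

theorem isWeightInvariant_mono {p : ℕ} {α : Fin p → MvPolynomial σ ℝ}
    (hα : ∀ i, IsWeightInvariant Y Z (α i)) (k : Fin p →₀ ℕ) :
    IsWeightInvariant Y Z (mono α k) :=
  Finset.prod_induction _ _ (fun _ _ => IsWeightInvariant.mul) isWeightInvariant_one
    fun i _ => (hα i).pow _

end Triad

theorem mono_zero {σ : Type*} {p : ℕ} (α : Fin p → MvPolynomial σ ℝ) : mono α 0 = 1 := by simp [mono]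

theorem mono_add {σ : Type*} {p : ℕ} (α : Fin p → MvPolynomial σ ℝ) (k l : Fin p →₀ ℕ) :
    mono α (k + l) = mono α k * mono α l := by
  simp [mono, pow_add, Finset.prod_mul_distrib]

/-! ### Transvectants -/

section Transvectant

variable {σ τ : Type*} [Fintype σ] [Fintype τ] {X₁ Y₁ Z₁ : Matrix σ σ ℝ} {X₂ Y₂ Z₂ : Matrix τ τ ℝ}

/-- The recursion that makes neighbouring terms of a transvectant cancel under `D_Y`. -/
theorem transvectantCoeff_succ {a b s j : ℕ} (hj : j < s) (ha : s ≤ a) (hb : s ≤ b) :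
    transvectantCoeff a b s (j + 1) * (((j : ℝ) + 1) * (a - j)) =
      transvectantCoeff a b s j * (((s - j - 1 : ℕ) + 1 : ℝ) * (b - (s - j - 1 : ℕ))) := by
  obtain ⟨t, rfl⟩ : ∃ t, s = j + 1 + t := ⟨s - (j + 1), by omega⟩
  obtain ⟨a, rfl⟩ := Nat.exists_eq_add_of_le ha
  obtain ⟨b, rfl⟩ := Nat.exists_eq_add_of_le hb
  have hc : ((j + 1 + t).choose (j + 1) : ℝ) * ((j : ℝ) + 1) =
      ((j + 1 + t).choose j : ℝ) * ((t : ℝ) + 1) := by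
    have := Nat.choose_succ_right_eq (j + 1 + t) j
    rw [show j + 1 + t - j = t + 1 by omega] at this
    exact_mod_cast this
  simp only [transvectantCoeff, show j + 1 + t - j - 1 = t by omega,
    show j + 1 + t + a - (j + 1) = t + a by omega,
    show j + 1 + t + a - j = t + a + 1 by omega,
    show j + 1 + t + a - (j + 1 + t) = a by omega,
    show j + 1 + t + b - (j + 1 + t) = b by omega,
    show b + (j + 1) = b + j + 1 by omega, Nat.factorial_succ]
  push_cast
  linear_combination ((1 : ℝ) + t + a) * (((t + a).factorial : ℝ) / (a.factorial : ℝ)) *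
    (((b : ℝ) + j + 1) * ((b + j).factorial : ℝ) / (b.factorial : ℝ)) * hc

/-- Transvectants are invariants of the block-diagonal triad. -/
theorem linDeriv_transvectant (h₁ : IsTriad X₁ Y₁ Z₁) (h₂ : IsTriad X₂ Y₂ Z₂)
    {f : MvPolynomial σ ℝ} {g : MvPolynomial τ ℝ} (hf : IsWeightInvariant Y₁ Z₁ f)
    (hg : IsWeightInvariant Y₂ Z₂ g) {s : ℕ} (hs₁ : s ≤ weight Z₁ f) (hs₂ : s ≤ weight Z₂ g) :
    linDeriv (Matrix.fromBlocks Y₁ 0 0 Y₂) (transvectant X₁ Z₁ X₂ Z₂ f g s) = 0 := by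
  have hfw := hf.linDeriv_eq_weight h₁
  have hgw := hg.linDeriv_eq_weight h₂
  set a := weight Z₁ f with ha
  set b := weight Z₂ g with hb
  have e₁ := raise_lower_iterate h₁.raise_lower h₁.weight_lower hf.invariant hfw
  have e₂ := raise_lower_iterate h₂.raise_lower h₂.weight_lower hg.invariant hgw
  simp only [transvectant, ← ha, ← hb, map_sum, map_smul, linDeriv_mul,
    linDeriv_fromBlocks_rename_inl, linDeriv_fromBlocks_rename_inr, smul_add,
    Finset.sum_add_distrib]
  -- The terms in which the first factor is raised cancel those in which the second one is.
  rw [Finset.sum_range_succ', Finset.sum_range_succ (fun j => _ • (_ * rename _ (linDeriv Y₂ _)))]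
  simp only [Function.iterate_zero, id, hf.invariant, hg.invariant, Nat.sub_self, map_zero,
    zero_mul, mul_zero, smul_zero, add_zero]
  rw [← Finset.sum_add_distrib]
  refine Finset.sum_eq_zero fun j hj => ?_
  have hj := Finset.mem_range.1 hj
  have hsj : s - j = s - j - 1 + 1 := by omega
  have hc := transvectantCoeff_succ hj hs₁ hs₂
  rw [e₁, show s - (j + 1) = s - j - 1 by omega]
  nth_rw 2 [hsj]
  rw [e₂, map_smul, map_smul, smul_mul_assoc, mul_smul_comm, smul_smul, smul_smul, ← add_smul]
  convert zero_smul ℝ _ using 2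
  rw [pow_succ]
  linear_combination (-(-1) ^ j) * hc

theorem transvectantCoeff_zero_ne_zero (a b s : ℕ) : transvectantCoeff a b s 0 ≠ 0 := by
  simp only [transvectantCoeff, Nat.choose_zero_right]
  positivity

/-- `D_{Y₂} ^ s` kills all terms of `(f, g)^(s)` but `f · D_{X₂} ^ s g`, which it maps to a multiple
of `f g`. -/
theorem hasLeadingTerm_transvectant (h₂ : IsTriad X₂ Y₂ Z₂) (f : MvPolynomial σ ℝ)
    {g : MvPolynomial τ ℝ} (hg : IsWeightInvariant Y₂ Z₂ g) {s : ℕ} (hs₂ : s ≤ weight Z₂ g) :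
    HasLeadingTerm (Matrix.fromBlocks 0 0 0 Y₂) s (transvectant X₁ Z₁ X₂ Z₂ f g s)
      (rename Sum.inl f * rename Sum.inr g) := by
  have hgw := hg.linDeriv_eq_weight h₂
  have hD : ∀ (n : ℕ) (u : MvPolynomial σ ℝ) (v : MvPolynomial τ ℝ),
      (linDeriv (Matrix.fromBlocks 0 0 0 Y₂))^[n] (rename Sum.inl u * rename Sum.inr v) =
        rename Sum.inl u * rename Sum.inr ((linDeriv Y₂)^[n] v) := by
    intro n u v
    induction n with
    | zero => rfl
    | succ n ih =>
      rw [Function.iterate_succ_apply', ih, linDeriv_mul, linDeriv_fromBlocks_rename_inl,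
        linDeriv_fromBlocks_rename_inr, Function.iterate_succ_apply']
      simp [linDeriv_apply]
  have hvanish : ∀ j, (linDeriv Y₂)^[j + 1] ((linDeriv X₂)^[j] g) = 0 ∨ weight Z₂ g < j := by
    intro j
    by_cases hj : j ≤ weight Z₂ g
    · obtain ⟨c, -, hc⟩ := raise_iterate_lower_iterate h₂.raise_lower h₂.weight_lower
        hg.invariant hgw hj
      left
      rw [Function.iterate_succ_apply', hc, map_smul, hg.invariant, smul_zero]
    · exact Or.inr (by omega)
  have hkill : ∀ j n, j < n → j ≤ s → (linDeriv Y₂)^[n] ((linDeriv X₂)^[j] g) = 0 :=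
    fun j n hjn hjs => linDeriv_iterate_eq_zero_of_le Y₂ hjn
      ((hvanish j).resolve_right (by omega))
  constructor
  · rw [transvectant, ← Module.End.pow_apply, map_sum]
    refine Finset.sum_eq_zero fun j _ => ?_
    rw [Module.End.pow_apply, iterate_linearMap_smul, hD, hkill _ _ (by omega) (by omega)]
    simp
  · obtain ⟨c, hc, hcg⟩ := raise_iterate_lower_iterate h₂.raise_lower h₂.weight_lower
      hg.invariant hgw hs₂
    refine ⟨transvectantCoeff (weight Z₁ f) (weight Z₂ g) s 0 * c,
      mul_ne_zero (transvectantCoeff_zero_ne_zero _ _ _) hc, ?_⟩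
    rw [transvectant, ← Module.End.pow_apply, map_sum,
      Finset.sum_eq_single_of_mem 0 (Finset.mem_range.2 (by omega))]
    · rw [Module.End.pow_apply, iterate_linearMap_smul, hD, Nat.sub_zero, hcg]
      simp [mul_smul]
    · intro j hjs hj
      have := Finset.mem_range.1 hjs
      rw [Module.End.pow_apply, iterate_linearMap_smul, hD, hkill _ _ (by omega) (by omega)]
      simp

theorem isHomogeneous_transvectant {f : MvPolynomial σ ℝ} {g : MvPolynomial τ ℝ} {d e : ℕ}
    (hf : f.IsHomogeneous d) (hg : g.IsHomogeneous e) (s : ℕ) :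
    (transvectant X₁ Z₁ X₂ Z₂ f g s).IsHomogeneous (d + e) := by
  refine IsHomogeneous.sum _ _ _ fun j _ => ?_
  rw [smul_eq_C_mul]
  exact (((isHomogeneous_linDeriv_iterate X₁ hf j).rename_isHomogeneous).mul
    ((isHomogeneous_linDeriv_iterate X₂ hg _).rename_isHomogeneous)).C_mul _

variable {p q : ℕ} {α : Fin p → MvPolynomial σ ℝ} {β : Fin q → MvPolynomial τ ℝ}

/-- The product `α ^ k β ^ l` in `ℝ[x, y]`. -/
noncomputable def monoProd (α : Fin p → MvPolynomial σ ℝ) (β : Fin q → MvPolynomial τ ℝ)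
    (k : Fin p →₀ ℕ) (l : Fin q →₀ ℕ) : MvPolynomial (σ ⊕ τ) ℝ :=
  rename Sum.inl (mono α k) * rename Sum.inr (mono β l)

/-- A product of well-defined transvectants is a homogeneous invariant, and its leading term with
respect to `D_{Y₂}` depends on the sum of the vectors of the factors only. -/
theorem transvectantMonomial_properties (h₁ : IsTriad X₁ Y₁ Z₁) (h₂ : IsTriad X₂ Y₂ Z₂)
    (hα : ∀ i, IsWeightInvariant Y₁ Z₁ (α i)) (hβ : ∀ i, IsWeightInvariant Y₂ Z₂ (β i))
    (M : Multiset (ExpVec p q)) (hM : ∀ u ∈ M, IsWellDefined Z₁ Z₂ α β u) :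
    (∃ d, (transvectantMonomial X₁ Z₁ X₂ Z₂ α β M).IsHomogeneous d) ∧
      linDeriv (Matrix.fromBlocks Y₁ 0 0 Y₂) (transvectantMonomial X₁ Z₁ X₂ Z₂ α β M) = 0 ∧
      HasLeadingTerm (Matrix.fromBlocks 0 0 0 Y₂) M.sum.2.2
        (transvectantMonomial X₁ Z₁ X₂ Z₂ α β M) (monoProd α β M.sum.1 M.sum.2.1) := by
  induction M using Multiset.induction_on with
  | empty =>
    refine ⟨⟨0, ?_⟩, ?_, ?_⟩
    · simpa [transvectantMonomial] using isHomogeneous_one _ _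
    · simp [transvectantMonomial]
    · simpa [transvectantMonomial, monoProd, mono_zero] using HasLeadingTerm.one _
  | cons v M ih =>
    obtain ⟨⟨d, hd⟩, hinv, hlead⟩ := ih fun u hu => hM u (Multiset.mem_cons_of_mem hu)
    have hv := hM v (Multiset.mem_cons_self v M)
    have hf := isWeightInvariant_mono hα v.1
    have hg := isWeightInvariant_mono hβ v.2.1
    obtain ⟨d₁, hd₁⟩ := hf.homogeneous
    obtain ⟨d₂, hd₂⟩ := hg.homogeneous
    have hcons : transvectantMonomial X₁ Z₁ X₂ Z₂ α β (v ::ₘ M) =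
        monoTransvectant X₁ Z₁ X₂ Z₂ α β v * transvectantMonomial X₁ Z₁ X₂ Z₂ α β M := by
      simp [transvectantMonomial]
    rw [hcons]
    refine ⟨⟨_, (isHomogeneous_transvectant hd₁ hd₂ v.2.2).mul hd⟩, ?_, ?_⟩
    · rw [linDeriv_mul, hinv, monoTransvectant,
        linDeriv_transvectant h₁ h₂ hf hg hv.1 hv.2, zero_mul, mul_zero, add_zero]
    · have hmul : monoProd α β (v + M.sum).1 (v + M.sum).2.1 =
          rename Sum.inl (mono α v.1) * rename Sum.inr (mono β v.2.1) *
            monoProd α β M.sum.1 M.sum.2.1 := by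
        simp only [Prod.fst_add, Prod.snd_add, monoProd, mono_add, map_mul]
        ring
      rw [Multiset.sum_cons, hmul]
      exact (hasLeadingTerm_transvectant h₂ (mono α v.1) hg hv.2).mul hlead

end Transvectant

/-! ### Invariants of both blocks -/

section Tensor

/-- Over a field, the kernels of `N₁ ⊗ 1` and `1 ⊗ N₂` meet in `ker N₁ ⊗ ker N₂`. -/
theorem mem_range_map_ker_subtype {V W : Type*} [AddCommGroup V] [Module ℝ V] [AddCommGroup W]
    [Module ℝ W] (N₁ : V →ₗ[ℝ] V) (N₂ : W →ₗ[ℝ] W) {t : V ⊗[ℝ] W}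
    (h₁ : N₁.rTensor W t = 0) (h₂ : N₂.lTensor V t = 0) :
    t ∈ LinearMap.range (TensorProduct.map N₁.ker.subtype N₂.ker.subtype) := by
  obtain ⟨r, rfl⟩ := (Module.Flat.lTensor_exact V
    (LinearMap.exact_subtype_ker_map N₂) t).1 h₂
  have hr : N₁.rTensor N₂.ker r = 0 := by
    apply Module.Flat.lTensor_preserves_injective_linearMap (M := V) _
      N₂.ker.subtype_injective
    rw [map_zero, ← h₁, ← LinearMap.comp_apply, ← LinearMap.comp_apply,
      LinearMap.lTensor_comp_rTensor, LinearMap.rTensor_comp_lTensor]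
  obtain ⟨u, rfl⟩ := (Module.Flat.rTensor_exact N₂.ker
    (LinearMap.exact_subtype_ker_map N₁) r).1 hr
  exact ⟨u, by rw [← LinearMap.comp_apply, LinearMap.lTensor_comp_rTensor]⟩

theorem tensorEquivSum_tmul {σ τ : Type*} (f : MvPolynomial σ ℝ) (g : MvPolynomial τ ℝ) :
    tensorEquivSum ℝ σ τ ℝ (f ⊗ₜ g) = rename Sum.inl f * rename Sum.inr g := by
  have hf : tensorEquivSum ℝ σ τ ℝ (f ⊗ₜ 1) = rename Sum.inl f := by
    induction f using MvPolynomial.induction_on with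
    | C a => simp
    | add p q hp hq => rw [TensorProduct.add_tmul, map_add, hp, hq, map_add]
    | mul_X p i hp =>
      rw [← mul_one (1 : MvPolynomial τ ℝ), ← Algebra.TensorProduct.tmul_mul_tmul, map_mul, hp]
      simp
  have hg : tensorEquivSum ℝ σ τ ℝ (1 ⊗ₜ g) = rename Sum.inr g := by
    induction g using MvPolynomial.induction_on with
    | C a => simp
    | add p q hp hq => rw [TensorProduct.tmul_add, map_add, hp, hq, map_add]
    | mul_X p i hp =>
      rw [← mul_one (1 : MvPolynomial σ ℝ), ← Algebra.TensorProduct.tmul_mul_tmul, map_mul, hp]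
      simp
  rw [← hf, ← hg, ← map_mul, Algebra.TensorProduct.tmul_mul_tmul, mul_one, one_mul]

/-- If the families `a` and `b` span `ker D_{Y₁}` and `ker D_{Y₂}`, then their products span the
polynomials in `ℝ[x, y]` that are invariant in `x` and in `y` separately. -/
theorem mem_span_mul_of_linDeriv_eq_zero {σ τ : Type*} [Fintype σ] [Fintype τ]
    {Y₁ : Matrix σ σ ℝ} {Y₂ : Matrix τ τ ℝ}
    {S : Set (MvPolynomial σ ℝ)} {T : Set (MvPolynomial τ ℝ)}
    (hS : LinearMap.ker (linDeriv Y₁) ≤ Submodule.span ℝ S)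
    (hT : LinearMap.ker (linDeriv Y₂) ≤ Submodule.span ℝ T) {F : MvPolynomial (σ ⊕ τ) ℝ}
    (h₁ : linDeriv (Matrix.fromBlocks Y₁ 0 0 0) F = 0)
    (h₂ : linDeriv (Matrix.fromBlocks 0 0 0 Y₂) F = 0) :
    F ∈ Submodule.span ℝ
      (Set.image2 (fun f g => rename Sum.inl f * rename Sum.inr g) S T) := by
  obtain ⟨t, rfl⟩ := (tensorEquivSum ℝ σ τ ℝ).surjective F
  have e₁ : ∀ t, linDeriv (Matrix.fromBlocks Y₁ 0 0 0) (tensorEquivSum ℝ σ τ ℝ t) =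
      tensorEquivSum ℝ σ τ ℝ ((linDeriv Y₁).rTensor _ t) := by
    intro t
    induction t using TensorProduct.induction_on with
    | zero => simp
    | add x y hx hy => simp only [map_add, hx, hy]
    | tmul f g =>
      rw [tensorEquivSum_tmul, LinearMap.rTensor_tmul, tensorEquivSum_tmul, linDeriv_mul,
        linDeriv_fromBlocks_rename_inl, linDeriv_fromBlocks_rename_inr]
      simp [linDeriv_apply]
  have e₂ : ∀ t, linDeriv (Matrix.fromBlocks 0 0 0 Y₂) (tensorEquivSum ℝ σ τ ℝ t) =
      tensorEquivSum ℝ σ τ ℝ ((linDeriv Y₂).lTensor _ t) := by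
    intro t
    induction t using TensorProduct.induction_on with
    | zero => simp
    | add x y hx hy => simp only [map_add, hx, hy]
    | tmul f g =>
      rw [tensorEquivSum_tmul, LinearMap.lTensor_tmul, tensorEquivSum_tmul, linDeriv_mul,
        linDeriv_fromBlocks_rename_inl, linDeriv_fromBlocks_rename_inr]
      simp [linDeriv_apply]
  rw [e₁, map_eq_zero_iff _ (tensorEquivSum ℝ σ τ ℝ).injective] at h₁
  rw [e₂, map_eq_zero_iff _ (tensorEquivSum ℝ σ τ ℝ).injective] at h₂
  obtain ⟨u, rfl⟩ := mem_range_map_ker_subtype _ _ h₁ h₂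
  clear h₁ h₂
  induction u using TensorProduct.induction_on with
  | zero => simp
  | add x y hx hy => simp only [map_add]; exact Submodule.add_mem _ hx hy
  | tmul f g =>
    rw [TensorProduct.map_tmul, tensorEquivSum_tmul]
    let B : MvPolynomial σ ℝ →ₗ[ℝ] MvPolynomial τ ℝ →ₗ[ℝ] MvPolynomial (σ ⊕ τ) ℝ :=
      (LinearMap.mul ℝ _).compl₁₂ (rename Sum.inl).toLinearMap (rename Sum.inr).toLinearMap
    have := Submodule.apply_mem_map₂ B (hS f.2) (hT g.2)
    rwa [Submodule.map₂_span_span] at this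

theorem linearIndepOn_mul_rename {σ τ : Type*} {ι κ : Type*} {a : ι → MvPolynomial σ ℝ}
    {b : κ → MvPolynomial τ ℝ} {A : Set ι} {B : Set κ} (ha : LinearIndepOn ℝ a A)
    (hb : LinearIndepOn ℝ b B) :
    LinearIndepOn ℝ (fun i : ι × κ => rename Sum.inl (a i.1) * rename Sum.inr (b i.2))
      (A ×ˢ B) := by
  have : LinearIndepOn ℝ (fun i : ι × κ => a i.1 ⊗ₜ[ℝ] b i.2) (A ×ˢ B) :=
    ((LinearIndependent.tmul_of_flat_left ha hb).comp _ (Equiv.Set.prod _ _).injective :)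
  have := this.map_injOn (tensorEquivSum ℝ σ τ ℝ).toLinearMap
    (tensorEquivSum ℝ σ τ ℝ).injective.injOn
  simpa only [Function.comp_def, AlgEquiv.toLinearMap_apply, tensorEquivSum_tmul] using this

end Tensor

/-! ### Formal bases consisting of homogeneous polynomials -/

section FormalBasis

variable {σ : Type*} [Fintype σ]

/-- The inclusion of polynomials into formal power series, as a linear map. -/
noncomputable def toSeries (σ : Type*) : MvPolynomial σ ℝ →ₗ[ℝ] MvPowerSeries σ ℝ where
  toFun f := f
  map_add' f g := coe_add f g
  map_smul' c f := coe_smul f c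

theorem toSeries_apply {σ : Type*} (f : MvPolynomial σ ℝ) :
    toSeries σ f = (f : MvPowerSeries σ ℝ) := rfl

theorem toSeries_injective (σ : Type*) : Function.Injective (toSeries σ) := coe_injective σ ℝ

theorem formalLinDeriv_coe (A : Matrix σ σ ℝ) (f : MvPolynomial σ ℝ) :
    formalLinDeriv A (f : MvPowerSeries σ ℝ) = (linDeriv A f : MvPolynomial σ ℝ) := by
  have h : formalLinDeriv A (f : MvPowerSeries σ ℝ) =
    ∑ i, (∑ j, A i j • (MvPowerSeries.X j : MvPowerSeries σ ℝ)) *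
      MvPowerSeries.pderiv ℝ i (f : MvPowerSeries σ ℝ) := rfl
  rw [h, linDeriv_apply, ← toSeries_apply (∑ i, _), map_sum]
  refine Finset.sum_congr rfl fun i _ => ?_
  rw [toSeries_apply, coe_mul, ← toSeries_apply (∑ j, _), map_sum, MvPowerSeries.pderiv_coe]
  simp only [map_smul, toSeries_apply, coe_X]

theorem coe_mem_formalInvariants {Y : Matrix σ σ ℝ} {f : MvPolynomial σ ℝ} :
    (f : MvPowerSeries σ ℝ) ∈ formalInvariants Y ↔ linDeriv Y f = 0 := by
  rw [formalInvariants, LinearMap.mem_ker, formalLinDeriv_coe, coe_eq_zero_iff]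

/-- `D_A` preserves degrees: the coefficients of `D_A f` in degree `d` only depend on those of
`f`. -/
theorem coeff_formalLinDeriv_eq_zero (A : Matrix σ σ ℝ) {f : MvPowerSeries σ ℝ} {d : ℕ}
    (hf : ∀ e : σ →₀ ℕ, e.degree = d → MvPowerSeries.coeff e f = 0) (e : σ →₀ ℕ)
    (he : e.degree = d) : MvPowerSeries.coeff e (formalLinDeriv A f) = 0 := by
  classical
  have h : formalLinDeriv A f =
    ∑ i, (∑ j, A i j • (MvPowerSeries.X j : MvPowerSeries σ ℝ)) *
      MvPowerSeries.pderiv ℝ i f := rfl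
  simp only [h, Finset.sum_mul, map_sum, smul_mul_assoc, map_smul]
  refine Finset.sum_eq_zero fun i _ => Finset.sum_eq_zero fun j _ => ?_
  rw [MvPowerSeries.X, MvPowerSeries.coeff_monomial_mul]
  split_ifs with hj
  · rw [MvPowerSeries.coeff_pderiv, hf, zero_mul, mul_zero, smul_zero]
    have := congrArg Finsupp.degree (tsub_add_cancel_of_le hj)
    rw [map_add] at this
    rw [map_add, ← he, ← this]
    simp
  · simp

/-- The homogeneous component of degree `d` of a power series, as a polynomial. -/
noncomputable def homogeneousPart (d : ℕ) (f : MvPowerSeries σ ℝ) : MvPolynomial σ ℝ :=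
  homogeneousComponent d (MvPowerSeries.truncTotal (d + 1) f)

theorem coeff_homogeneousPart (d : ℕ) (f : MvPowerSeries σ ℝ) (e : σ →₀ ℕ) :
    (homogeneousPart d f).coeff e = if e.degree = d then MvPowerSeries.coeff e f else 0 := by
  rw [homogeneousPart, coeff_homogeneousComponent]
  split_ifs with h
  · rw [MvPowerSeries.coeff_truncTotal_eq_ite, if_pos (by omega)]
  · rfl

theorem linDeriv_homogeneousPart {A : Matrix σ σ ℝ} {f : MvPowerSeries σ ℝ}
    (hf : formalLinDeriv A f = 0) (d : ℕ) : linDeriv A (homogeneousPart d f) = 0 := by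
  have hhom : (homogeneousPart d f).IsHomogeneous d := homogeneousComponent_isHomogeneous _ _
  ext e
  by_cases he : e.degree = d
  · have := coeff_formalLinDeriv_eq_zero A (f := f - homogeneousPart d f) (d := d)
      (fun e he => by simp [coeff_homogeneousPart, he]) e he
    rw [map_sub, hf, zero_sub, map_neg, neg_eq_zero, formalLinDeriv_coe, coeff_coe] at this
    rw [this, coeff_zero]
  · rw [coeff_zero]
    exact (isHomogeneous_linDeriv A hhom).coeff_eq_zero he

variable {B : Set (MvPowerSeries σ ℝ)} {q : B → MvPolynomial σ ℝ}

/-- In a pointwise finite linear combination of homogeneous polynomials, only finitely many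
polynomials of each degree `d` occur, and they determine its component of degree `d`. -/
theorem exists_finset_sum_of_finite_support (hq : ∀ b, (q b : MvPowerSeries σ ℝ) = b)
    (hhom : ∀ b, ∃ d, (q b).IsHomogeneous d) (hne : ∀ b, q b ≠ 0) {c : B → ℝ}
    (hc : ∀ e : σ →₀ ℕ,
      (Function.support fun b : B => c b * MvPowerSeries.coeff e b.1).Finite) (d : ℕ) :
    ∃ s : Finset B, (∀ b, b ∈ s ↔ (q b).IsHomogeneous d ∧ c b ≠ 0) ∧
      ∀ e : σ →₀ ℕ, e.degree = d →
        ∑ᶠ b : B, c b * MvPowerSeries.coeff e b.1 = (∑ b ∈ s, c b • q b).coeff e := by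
  have hcoeff : ∀ (e : σ →₀ ℕ) (b : B), MvPowerSeries.coeff e b.1 = (q b).coeff e := by
    intro e b
    rw [← hq b, coeff_coe]
  have hfin : {b : B | (q b).IsHomogeneous d ∧ c b ≠ 0}.Finite := by
    refine ((Finsupp.finite_of_degree_eq d).biUnion fun e _ => hc e).subset ?_
    rintro b ⟨hb, hcb⟩
    obtain ⟨e, he⟩ := ne_zero_iff.1 (hne b)
    refine Set.mem_biUnion (x := e) ?_ ?_
    · by_contra hed
      exact he (hb.coeff_eq_zero hed)
    · rw [Function.mem_support, hcoeff]
      exact mul_ne_zero hcb he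
  refine ⟨hfin.toFinset, fun b => by simp, fun e he => ?_⟩
  rw [finsum_eq_sum_of_support_subset (s := hfin.toFinset)]
  · simp [coeff_sum, hcoeff]
  · intro b hb
    rw [Function.mem_support, hcoeff] at hb
    obtain ⟨d', hd'⟩ := hhom b
    have : e.degree = d' := by
      by_contra hed
      exact right_ne_zero_of_mul hb (hd'.coeff_eq_zero hed)
    simp only [Set.Finite.coe_toFinset, Set.mem_ofPred_eq]
    exact ⟨by rwa [← he, this], left_ne_zero_of_mul hb⟩

theorem linDeriv_homogeneousComponent {A : Matrix σ σ ℝ} {f : MvPolynomial σ ℝ}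
    (hf : linDeriv A f = 0) (d : ℕ) : linDeriv A (homogeneousComponent d f) = 0 := by
  have : homogeneousPart d (f : MvPowerSeries σ ℝ) = homogeneousComponent d f := by
    ext e
    simp [coeff_homogeneousPart, coeff_homogeneousComponent]
  rw [← this]
  exact linDeriv_homogeneousPart (by rw [formalLinDeriv_coe, hf, coe_zero]) d

/-- A formal basis of the formal invariants that consists of homogeneous polynomials spans the
polynomial invariants. -/
theorem IsFormalBasis.ker_linDeriv_le_span {Y : Matrix σ σ ℝ}
    (hB : IsFormalBasis (formalInvariants Y) B) (hq : ∀ b, (q b : MvPowerSeries σ ℝ) = b)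
    (hhom : ∀ b, ∃ d, (q b).IsHomogeneous d) :
    LinearMap.ker (linDeriv Y) ≤ Submodule.span ℝ (Set.range q) := by
  have hne : ∀ b, q b ≠ 0 := fun b hb =>
    LinearIndependent.ne_zero (R := ℝ) (v := fun b : B => id b.1) b hB.linearIndepOn
      (by simp [← hq b, hb])
  intro f hf
  rw [← sum_homogeneousComponent f]
  refine Submodule.sum_mem _ fun d _ => ?_
  have hfd := linDeriv_homogeneousComponent (LinearMap.mem_ker.1 hf) d
  obtain ⟨c, hc, -⟩ := hB.existsUnique_formalSum _ (coe_mem_formalInvariants.2 hfd)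
  obtain ⟨s, hs, hsum⟩ :=
    exists_finset_sum_of_finite_support hq hhom hne (fun e => (hc e).1) d
  have : homogeneousComponent d f = ∑ b ∈ s, c b • q b := by
    ext e
    by_cases he : e.degree = d
    · rw [← hsum e he, (hc e).2, coeff_coe]
    · rw [(homogeneousComponent_isHomogeneous d f).coeff_eq_zero he, coeff_sum]
      refine (Finset.sum_eq_zero fun b hb => ?_).symm
      rw [coeff_smul, ((hs b).1 hb).1.coeff_eq_zero he, smul_zero]
  rw [this]
  exact Submodule.sum_mem _ fun b _ =>
    Submodule.smul_mem _ _ (Submodule.subset_span (Set.mem_range_self b))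

/-- A linearly independent set of homogeneous polynomials that spans the polynomial invariants is a
formal basis of the formal invariants. -/
theorem isFormalBasis_of_span {Y : Matrix σ σ ℝ} (hli : LinearIndepOn ℝ id B)
    (hq : ∀ b, (q b : MvPowerSeries σ ℝ) = b) (hhom : ∀ b, ∃ d, (q b).IsHomogeneous d)
    (hspan : Submodule.span ℝ (Set.range q) = LinearMap.ker (linDeriv Y)) :
    IsFormalBasis (formalInvariants Y) B := by
  have hqli : LinearIndependent ℝ q := by
    refine LinearIndependent.of_comp (toSeries σ) ?_
    have : toSeries σ ∘ q = fun b : B => id b.1 := funext hq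
    rw [this]
    exact hli
  have hcoeff : ∀ (e : σ →₀ ℕ) (b : B), MvPowerSeries.coeff e b.1 = (q b).coeff e := by
    intro e b
    rw [← hq b, coeff_coe]
  refine ⟨fun b hb => ?_, hli, fun f hf => ?_⟩
  · rw [SetLike.mem_coe, show b = q ⟨b, hb⟩ from (hq ⟨b, hb⟩).symm, coe_mem_formalInvariants, ← LinearMap.mem_ker, ← hspan]
    exact Submodule.subset_span (Set.mem_range_self _)
  have hpart : ∀ d, ∃ r : B →₀ ℝ, Finsupp.linearCombination ℝ q r = homogeneousPart d f := by
    intro d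
    rw [← LinearMap.mem_range, Finsupp.range_linearCombination, hspan]
    exact linDeriv_homogeneousPart hf d
  choose r hr using hpart
  choose deg hdeg using hhom
  refine existsUnique_of_exists_of_unique ⟨fun b => r (deg b) b, fun e => ?_⟩ fun c c' hc hc' => ?_
  · -- In degree `|e|` the coefficients are those of the expansion of the component of `f`.
    have heq : (fun b : B => r (deg b) b * MvPowerSeries.coeff e b.1) =
        fun b => r e.degree b * (q b).coeff e := by
      funext b
      rw [hcoeff]
      by_cases h : e.degree = deg b
      · rw [h]
      · rw [(hdeg b).coeff_eq_zero h, mul_zero, mul_zero]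
    rw [heq]
    have hsub : (Function.support fun b => r e.degree b * (q b).coeff e) ⊆
        (r e.degree).support := by
      intro b hb
      exact Finsupp.mem_support_iff.2 (left_ne_zero_of_mul hb)
    refine ⟨(Finset.finite_toSet _).subset hsub, ?_⟩
    rw [finsum_eq_sum_of_support_subset _ hsub]
    have := congrArg (coeff e) (hr e.degree)
    rw [coeff_homogeneousPart, if_pos rfl, Finsupp.linearCombination_apply, Finsupp.sum,
      coeff_sum] at this
    simpa using this
  · have hfin : ∀ e : σ →₀ ℕ,
        (Function.support fun b : B => (c b - c' b) * MvPowerSeries.coeff e b.1).Finite := by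
      intro e
      refine ((hc e).1.union (hc' e).1).subset fun b hb => ?_
      by_contra h
      simp only [Set.mem_union, Function.mem_support, not_or, not_not] at h
      exact hb (by simp [sub_mul, h.1, h.2])
    funext b
    by_contra hne
    obtain ⟨s, hs, hsum⟩ := exists_finset_sum_of_finite_support hq (fun b => ⟨_, hdeg b⟩)
      hqli.ne_zero hfin (deg b)
    have hzero : ∑ b ∈ s, (c b - c' b) • q b = 0 := by
      ext e
      by_cases he : e.degree = deg b
      · rw [← hsum e he]
        simp only [sub_mul]
        rw [finsum_sub_distrib (hc e).1 (hc' e).1, (hc e).2, (hc' e).2, sub_self, coeff_zero]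
      · rw [coeff_sum, coeff_zero]
        refine Finset.sum_eq_zero fun b' hb' => ?_
        rw [coeff_smul, ((hs b').1 hb').1.coeff_eq_zero he, smul_zero]
    exact sub_ne_zero.2 hne (linearIndependent_iff'.1 hqli s _ hzero b
      ((hs b).2 ⟨hdeg b, sub_ne_zero.2 hne⟩))

end FormalBasis

/-! ### Bases of the joint invariants -/

section Bases

/-- Polynomials whose leading terms with respect to a derivation are linearly independent, for each
order separately, are linearly independent. -/
theorem linearIndepOn_of_hasLeadingTerm {σ ι : Type*} [Fintype σ] {D : Matrix σ σ ℝ}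
    {P h : ι → MvPolynomial σ ℝ} {s : ι → ℕ} {V : Set ι}
    (hP : ∀ v ∈ V, HasLeadingTerm D (s v) (P v) (h v))
    (hh : ∀ n, LinearIndepOn ℝ h {v ∈ V | s v = n}) : LinearIndepOn ℝ P V := by
  classical
  rw [linearIndepOn_iff']
  intro t g htV hsum
  by_contra! hne
  -- Apply the derivation as often as the highest order that occurs allows.
  obtain ⟨v₀, hv₀, hmax⟩ := (t.filter fun v => g v ≠ 0).exists_max_image s
    (by obtain ⟨v, hv, hgv⟩ := hne; exact ⟨v, by simp [hv, hgv]⟩)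
  obtain ⟨hv₀t, hgv₀⟩ := Finset.mem_filter.1 hv₀
  have hlead : ∀ v : ι, ∃ c : ℝ, c ≠ 0 ∧ (v ∈ V → (linDeriv D)^[s v] (P v) = c • h v) := by
    intro v
    by_cases hv : v ∈ V
    · obtain ⟨-, c, hc, hcv⟩ := hP v hv
      exact ⟨c, hc, fun _ => hcv⟩
    · exact ⟨1, one_ne_zero, fun hv' => absurd hv' hv⟩
  choose c hc hcv using hlead
  have hzero : ∑ v ∈ t.filter (fun v => s v = s v₀), (g v * c v) • h v = 0 := by
    have := congrArg ((linDeriv D)^[s v₀]) hsum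
    rw [iterate_map_zero, ← Module.End.pow_apply, map_sum] at this
    rw [← this, Finset.sum_filter]
    refine Finset.sum_congr rfl fun v hv => ?_
    rw [Module.End.pow_apply, iterate_linearMap_smul]
    split_ifs with hsv
    · rw [← hsv, hcv v (htV hv), smul_smul]
    · by_cases hgv : g v = 0
      · rw [hgv, zero_smul]
      · have hle := hmax v (Finset.mem_filter.2 ⟨hv, hgv⟩)
        rw [linDeriv_iterate_eq_zero_of_le D (by omega) (hP v (htV hv)).1, smul_zero]
  have hgc := linearIndepOn_iff'.1 (hh (s v₀)) _ (fun v => g v * c v) (fun v hv => by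
    obtain ⟨hvt, hsv⟩ := Finset.mem_filter.1 hv
    exact ⟨htV hvt, hsv⟩) hzero v₀ (Finset.mem_filter.2 ⟨hv₀t, rfl⟩)
  exact mul_ne_zero hgv₀ (hc v₀) hgc

/-- If `F` is killed by the sum of two commuting operators, then their iterates agree on `F` up to
sign. -/
theorem iterate_eq_neg_one_pow_smul {V : Type*} [AddCommGroup V] [Module ℝ V]
    {S T : V →ₗ[ℝ] V} (hST : ∀ u, S (T u) = T (S u)) {F : V} (hF : S F + T F = 0) (n : ℕ) :
    S^[n] F = (-1 : ℝ) ^ n • T^[n] F := by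
  induction n with
  | zero => simp
  | succ n ih =>
    have hcomm : S (T^[n] F) = T^[n] (S F) := Function.Commute.iterate_right hST n F
    rw [Function.iterate_succ_apply', ih, map_smul, hcomm, eq_neg_of_add_eq_zero_left hF,
      iterate_map_neg, ← Function.iterate_succ_apply, pow_succ]
    module

theorem IsPreferredSet.linearIndepOn_mono {σ : Type*} [Fintype σ] {p : ℕ} {Y : Matrix σ σ ℝ}
    {α : Fin p → MvPolynomial σ ℝ} {A : Set (Fin p →₀ ℕ)} (hA : IsPreferredSet Y α A) :
    LinearIndepOn ℝ (mono α) A :=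
  LinearIndependent.of_comp (toSeries σ)
    (hA.formalBasis.linearIndepOn.comp_of_image hA.injOn)

theorem IsPreferredSet.ker_le_span {σ : Type*} [Fintype σ] {p : ℕ} {Y Z : Matrix σ σ ℝ}
    {α : Fin p → MvPolynomial σ ℝ} {A : Set (Fin p →₀ ℕ)} (hA : IsPreferredSet Y α A)
    (hα : ∀ i, IsWeightInvariant Y Z (α i)) :
    LinearMap.ker (linDeriv Y) ≤ Submodule.span ℝ (mono α '' A) := by
  have hex : ∀ b : (fun k => (mono α k : MvPowerSeries σ ℝ)) '' A,
      ∃ k ∈ A, (mono α k : MvPowerSeries σ ℝ) = b := fun b => b.2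
  choose k hkA hk using hex
  refine (hA.formalBasis.ker_linDeriv_le_span (q := fun b => mono α (k b)) hk
    fun b => (isWeightInvariant_mono hα _).homogeneous).trans (Submodule.span_mono ?_)
  rintro _ ⟨b, rfl⟩
  exact ⟨k b, hkA b, rfl⟩

theorem linearIndepOn_monoProd {σ τ : Type*} {p q : ℕ}
    {α : Fin p → MvPolynomial σ ℝ} {β : Fin q → MvPolynomial τ ℝ} {A : Set (Fin p →₀ ℕ)}
    {B : Set (Fin q →₀ ℕ)} (hA : LinearIndepOn ℝ (mono α) A)
    (hB : LinearIndepOn ℝ (mono β) B) :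
    LinearIndepOn ℝ (fun i : (Fin p →₀ ℕ) × (Fin q →₀ ℕ) => monoProd α β i.1 i.2) (A ×ˢ B) :=
  linearIndepOn_mul_rename hA hB

variable {σ τ : Type*} [Fintype σ] [Fintype τ] {X₁ Y₁ Z₁ : Matrix σ σ ℝ}
  {X₂ Y₂ Z₂ : Matrix τ τ ℝ} {p q : ℕ} {α : Fin p → MvPolynomial σ ℝ}
  {β : Fin q → MvPolynomial τ ℝ} {A : Set (Fin p →₀ ℕ)} {B : Set (Fin q →₀ ℕ)}

/-- If `F` is a joint invariant and `D_{Y₂} ^ (n + 1) F = 0`, then `D_{Y₂} ^ n F` is a combination of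
products `α ^ k β ^ l` for which the transvectant `[k; l; n]` is admissible. This is because
`D_{Y₂} ^ n F = ± D_{Y₁} ^ n F` is a highest weight vector for both triads and lies in the range of
both `D_{Y₁} ^ n` and `D_{Y₂} ^ n`. -/
theorem exists_leading_expansion (h₁ : IsTriad X₁ Y₁ Z₁) (h₂ : IsTriad X₂ Y₂ Z₂)
    (hα : ∀ i, IsWeightInvariant Y₁ Z₁ (α i)) (hβ : ∀ i, IsWeightInvariant Y₂ Z₂ (β i))
    (hA : IsPreferredSet Y₁ α A) (hB : IsPreferredSet Y₂ β B) {F : MvPolynomial (σ ⊕ τ) ℝ}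
    (hF : linDeriv (Matrix.fromBlocks Y₁ 0 0 Y₂) F = 0) {n : ℕ}
    (hn : (linDeriv (Matrix.fromBlocks (0 : Matrix σ σ ℝ) 0 0 Y₂))^[n + 1] F = 0) :
    ∃ (t : Finset ((Fin p →₀ ℕ) × (Fin q →₀ ℕ))) (c : (Fin p →₀ ℕ) × (Fin q →₀ ℕ) → ℝ),
      (∀ i ∈ t, c i ≠ 0 → (i.1, i.2, n) ∈ admissibleVectors Z₁ Z₂ α β A B) ∧
      (linDeriv (Matrix.fromBlocks (0 : Matrix σ σ ℝ) 0 0 Y₂))^[n] F =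
        ∑ i ∈ t, c i • monoProd α β i.1 i.2 := by
  classical
  set S := linDeriv (Matrix.fromBlocks Y₁ 0 0 (0 : Matrix τ τ ℝ)) with hS
  set T := linDeriv (Matrix.fromBlocks (0 : Matrix σ σ ℝ) 0 0 Y₂) with hT
  have hST : ∀ u, S (T u) = T (S u) := by
    intro u
    rw [← sub_eq_zero, hS, hT, linDeriv_comm]
    simp [Matrix.fromBlocks_multiply, linDeriv_apply]
  have hSTF : S F + T F = 0 := by
    rw [hS, hT, ← linDeriv_add_left, Matrix.fromBlocks_add]
    simpa using hF
  have hSn := iterate_eq_neg_one_pow_smul hST hSTF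
  have hSG : S (T^[n] F) = 0 := by
    have hcomm : S (T^[n] F) = T^[n] (S F) := Function.Commute.iterate_right hST n F
    rw [hcomm, eq_neg_of_add_eq_zero_left hSTF, iterate_map_neg, ← Function.iterate_succ_apply,
      hn, neg_zero]
  have hTG : T (T^[n] F) = 0 := by rw [← Function.iterate_succ_apply' T, hn]
  have hmem := mem_span_mul_of_linDeriv_eq_zero (hA.ker_le_span hα) (hB.ker_le_span hβ) hSG hTG
  have himage : Set.image2 (fun f g => rename Sum.inl f * rename Sum.inr g) (mono α '' A)
      (mono β '' B) = (fun i : (Fin p →₀ ℕ) × (Fin q →₀ ℕ) => monoProd α β i.1 i.2) '' A ×ˢ B := by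
    rw [Set.image2_image_left, Set.image2_image_right, ← Set.image_prod]
    rfl
  rw [himage, Finsupp.mem_span_image_iff_linearCombination] at hmem
  obtain ⟨c, hcs, hc⟩ := hmem
  rw [Finsupp.linearCombination_apply, Finsupp.sum] at hc
  have hli := (linearIndepOn_monoProd hA.linearIndepOn_mono hB.linearIndepOn_mono).mono
    ((Finsupp.mem_supported ℝ c).1 hcs)
  refine ⟨c.support, c, fun i hi hci => ?_, hc.symm⟩
  obtain ⟨hiA, hiB⟩ := Set.mem_prod.1 ((Finsupp.mem_supported ℝ c).1 hcs hi)
  have hw₁ : ∀ i ∈ c.support, linDeriv (Matrix.fromBlocks Z₁ 0 0 (0 : Matrix τ τ ℝ))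
      (monoProd α β i.1 i.2) = (weight Z₁ (mono α i.1) : ℝ) • monoProd α β i.1 i.2 := by
    intro i _
    rw [monoProd, linDeriv_mul, linDeriv_fromBlocks_rename_inl, linDeriv_fromBlocks_rename_inr,
      (isWeightInvariant_mono hα i.1).linDeriv_eq_weight h₁]
    simp [linDeriv_apply]
  have hw₂ : ∀ i ∈ c.support, linDeriv (Matrix.fromBlocks (0 : Matrix σ σ ℝ) 0 0 Z₂)
      (monoProd α β i.1 i.2) = (weight Z₂ (mono β i.2) : ℝ) • monoProd α β i.1 i.2 := by
    intro i _
    rw [monoProd, linDeriv_mul, linDeriv_fromBlocks_rename_inl, linDeriv_fromBlocks_rename_inr,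
      (isWeightInvariant_mono hβ i.2).linDeriv_eq_weight h₂]
    simp [linDeriv_apply]
  have t₁ := h₁.fromBlocks (isTriad_zero (σ := τ))
  have t₂ := (isTriad_zero (σ := σ)).fromBlocks h₂
  refine ⟨hiA, hiB, ?_, ?_⟩
  · obtain ⟨M, hM⟩ := t₁.exists_lower_iterate_eq_zero F
    obtain ⟨m, hm⟩ := exists_weight_eq_of_raise_iterate t₁.raise_lower t₁.weight_raise hli hw₁
      M n F (fun i => (-1) ^ n * c i) (by rw [← hS, hSn, hn, smul_zero]) hM
      (by rw [← hS, hSn, ← hc, Finset.smul_sum]; simp only [smul_smul]) i hi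
      (mul_ne_zero (pow_ne_zero _ (by norm_num)) hci)
    have hm : weight Z₁ (mono α i.1) = n + m := by exact_mod_cast hm
    exact hm ▸ Nat.le_add_right n m
  · obtain ⟨M, hM⟩ := t₂.exists_lower_iterate_eq_zero F
    obtain ⟨m, hm⟩ := exists_weight_eq_of_raise_iterate t₂.raise_lower t₂.weight_raise hli hw₂
      M n F c hn hM hc.symm i hi hci
    have hm : weight Z₂ (mono β i.2) = n + m := by exact_mod_cast hm
    exact hm ▸ Nat.le_add_right n m

/-- Joint invariants with the leading terms of the admissible transvectants span all joint
invariants: subtracting a combination of them lowers the order of nilpotency of `D_{Y₂}`. -/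
theorem mem_span_of_hasLeadingTerm (h₁ : IsTriad X₁ Y₁ Z₁) (h₂ : IsTriad X₂ Y₂ Z₂)
    (hα : ∀ i, IsWeightInvariant Y₁ Z₁ (α i)) (hβ : ∀ i, IsWeightInvariant Y₂ Z₂ (β i))
    (hA : IsPreferredSet Y₁ α A) (hB : IsPreferredSet Y₂ β B)
    {P : ExpVec p q → MvPolynomial (σ ⊕ τ) ℝ}
    (hinv : ∀ v ∈ admissibleVectors Z₁ Z₂ α β A B,
      linDeriv (Matrix.fromBlocks Y₁ 0 0 Y₂) (P v) = 0)
    (hlead : ∀ v ∈ admissibleVectors Z₁ Z₂ α β A B,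
      HasLeadingTerm (Matrix.fromBlocks (0 : Matrix σ σ ℝ) 0 0 Y₂) v.2.2 (P v)
        (monoProd α β v.1 v.2.1)) (n : ℕ) :
    ∀ F : MvPolynomial (σ ⊕ τ) ℝ, linDeriv (Matrix.fromBlocks Y₁ 0 0 Y₂) F = 0 →
      (linDeriv (Matrix.fromBlocks (0 : Matrix σ σ ℝ) 0 0 Y₂))^[n] F = 0 →
      F ∈ Submodule.span ℝ (P '' admissibleVectors Z₁ Z₂ α β A B) := by
  induction n with
  | zero =>
    intro F _ hF
    rw [show F = 0 from hF]
    exact Submodule.zero_mem _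
  | succ n ih =>
    intro F hF hFn
    obtain ⟨t, c, htc, hG⟩ := exists_leading_expansion h₁ h₂ hα hβ hA hB hF hFn
    have hd : ∀ i : (Fin p →₀ ℕ) × (Fin q →₀ ℕ), ∃ d : ℝ,
        (d ≠ 0 → (i.1, i.2, n) ∈ admissibleVectors Z₁ Z₂ α β A B) ∧
        (i ∈ t → (linDeriv (Matrix.fromBlocks (0 : Matrix σ σ ℝ) 0 0 Y₂))^[n]
          (d • P (i.1, i.2, n)) = c i • monoProd α β i.1 i.2) := by
      intro i
      by_cases hi : i ∈ t ∧ c i ≠ 0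
      · have hv := htc i hi.1 hi.2
        obtain ⟨-, e, he, hPe⟩ := hlead _ hv
        refine ⟨c i / e, fun _ => hv, fun _ => ?_⟩
        rw [iterate_linearMap_smul, hPe, smul_smul, div_mul_cancel₀ _ he]
      · refine ⟨0, fun h => absurd rfl h, fun hit => ?_⟩
        rw [zero_smul, iterate_map_zero, not_not.1 fun h => hi ⟨hit, h⟩, zero_smul]
    choose d hdV hdt using hd
    have hmem : ∑ i ∈ t, d i • P (i.1, i.2, n) ∈
        Submodule.span ℝ (P '' admissibleVectors Z₁ Z₂ α β A B) := by
      refine Submodule.sum_mem _ fun i _ => ?_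
      by_cases hdi : d i = 0
      · rw [hdi, zero_smul]
        exact Submodule.zero_mem _
      · exact Submodule.smul_mem _ _ (Submodule.subset_span ⟨_, hdV i hdi, rfl⟩)
    rw [← sub_add_cancel F (∑ i ∈ t, d i • P (i.1, i.2, n))]
    refine Submodule.add_mem _ (ih _ ?_ ?_) hmem
    · rw [map_sub, hF, map_sum, zero_sub, neg_eq_zero]
      refine Finset.sum_eq_zero fun i _ => ?_
      by_cases hdi : d i = 0
      · rw [hdi, zero_smul, map_zero]
      · rw [map_smul, hinv _ (hdV i hdi), smul_zero]
    · rw [← Module.End.pow_apply, map_sub, map_sum, Module.End.pow_apply, hG, sub_eq_zero]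
      refine Finset.sum_congr rfl fun i hi => ?_
      rw [Module.End.pow_apply, hdt i hi]

end Bases

end BoxProduct

open BoxProduct in
/-- Replacement theorem. `ρ` chooses a replacement for every element of the pre-box product; the
resulting products are pairwise distinct and form a formal vector space basis of the formal
invariants of the block-diagonal triad. -/
theorem theorem9p2 {n m p q : ℕ}
    (X₁ Y₁ Z₁ : Matrix (Fin n) (Fin n) ℝ) (h₁ : BoxProduct.IsTriad X₁ Y₁ Z₁)
    (X₂ Y₂ Z₂ : Matrix (Fin m) (Fin m) ℝ) (h₂ : BoxProduct.IsTriad X₂ Y₂ Z₂)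
    (α : Fin p → MvPolynomial (Fin n) ℝ) (hα : BoxProduct.IsHilbertBasis Y₁ Z₁ α)
    (β : Fin q → MvPolynomial (Fin m) ℝ) (hβ : BoxProduct.IsHilbertBasis Y₂ Z₂ β)
    (A : Set (Fin p →₀ ℕ)) (hA : BoxProduct.IsPreferredSet Y₁ α A)
    (hA' : BoxProduct.IsStandardSet A)
    (B : Set (Fin q →₀ ℕ)) (hB : BoxProduct.IsPreferredSet Y₂ β B)
    (hB' : BoxProduct.IsStandardSet B)
    (ρ : BoxProduct.ExpVec p q → Multiset (BoxProduct.ExpVec p q))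
    (hρ : ∀ v ∈ BoxProduct.admissibleVectors Z₁ Z₂ α β A B,
      BoxProduct.IsReplacement Z₁ Z₂ α β (ρ v) v) :
    Set.InjOn
        (fun v => (BoxProduct.transvectantMonomial X₁ Z₁ X₂ Z₂ α β (ρ v) :
          MvPowerSeries (Fin n ⊕ Fin m) ℝ))
        (BoxProduct.admissibleVectors Z₁ Z₂ α β A B) ∧
      BoxProduct.IsFormalBasis
        (BoxProduct.formalInvariants (Matrix.fromBlocks Y₁ 0 0 Y₂))
        ((fun v => (BoxProduct.transvectantMonomial X₁ Z₁ X₂ Z₂ α β (ρ v) :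
            MvPowerSeries (Fin n ⊕ Fin m) ℝ)) ''
          BoxProduct.admissibleVectors Z₁ Z₂ α β A B) := by
  have hprop : ∀ v ∈ admissibleVectors Z₁ Z₂ α β A B,
      (∃ d, (transvectantMonomial X₁ Z₁ X₂ Z₂ α β (ρ v)).IsHomogeneous d) ∧
        linDeriv (Matrix.fromBlocks Y₁ 0 0 Y₂) (transvectantMonomial X₁ Z₁ X₂ Z₂ α β (ρ v)) = 0 ∧
        HasLeadingTerm (Matrix.fromBlocks 0 0 0 Y₂) v.2.2
          (transvectantMonomial X₁ Z₁ X₂ Z₂ α β (ρ v)) (monoProd α β v.1 v.2.1) := by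
    intro v hv
    have := transvectantMonomial_properties h₁ h₂ hα.weightInvariant hβ.weightInvariant (ρ v)
      (hρ v hv).wellDefined
    rwa [(hρ v hv).sum_eq] at this
  have hli : LinearIndepOn ℝ (fun v => transvectantMonomial X₁ Z₁ X₂ Z₂ α β (ρ v))
      (admissibleVectors Z₁ Z₂ α β A B) := by
    refine linearIndepOn_of_hasLeadingTerm (s := fun v => v.2.2) (fun v hv => (hprop v hv).2.2)
      fun n => ?_
    refine LinearIndepOn.comp_of_image
      (v := fun i : (Fin p →₀ ℕ) × (Fin q →₀ ℕ) => monoProd α β i.1 i.2)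
      (f := fun v : ExpVec p q => (v.1, v.2.1)) ?_ ?_
    · refine (linearIndepOn_monoProd hA.linearIndepOn_mono hB.linearIndepOn_mono).mono ?_
      rintro _ ⟨v, ⟨hv, -⟩, rfl⟩
      exact ⟨hv.1, hv.2.1⟩
    · rintro ⟨k, l, s⟩ ⟨-, hs⟩ ⟨k', l', s'⟩ ⟨-, hs'⟩ h
      simp only [Prod.mk.injEq] at h hs hs'
      rw [h.1, h.2, hs, hs']
  have hliS := hli.map_injOn (toSeries _) (toSeries_injective _).injOn
  refine ⟨hliS.injOn, ?_⟩
  have hex : ∀ b : (fun v => (transvectantMonomial X₁ Z₁ X₂ Z₂ α β (ρ v) :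
      MvPowerSeries (Fin n ⊕ Fin m) ℝ)) '' admissibleVectors Z₁ Z₂ α β A B,
      ∃ v ∈ admissibleVectors Z₁ Z₂ α β A B, (transvectantMonomial X₁ Z₁ X₂ Z₂ α β (ρ v) :
        MvPowerSeries (Fin n ⊕ Fin m) ℝ) = b := fun b => b.2
  choose w hwV hw using hex
  refine isFormalBasis_of_span hliS.id_image hw (fun b => (hprop _ (hwV b)).1)
    (le_antisymm ?_ fun F hF => ?_)
  · rw [Submodule.span_le]
    rintro _ ⟨b, rfl⟩
    exact (hprop _ (hwV b)).2.1
  · obtain ⟨N, hN⟩ := (isTriad_zero.fromBlocks h₂).exists_raise_iterate_eq_zero F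
    refine Submodule.span_mono ?_ (mem_span_of_hasLeadingTerm h₁ h₂ hα.weightInvariant
      hβ.weightInvariant hA hB (fun v hv => (hprop v hv).2.1) (fun v hv => (hprop v hv).2.2)
      N F hF hN)
    rintro _ ⟨v, hv, rfl⟩
    exact ⟨⟨_, v, hv, rfl⟩, coe_injective _ _ (hw _)⟩
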